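/- Let $G$ be a finite connected undirected simple graph with $n=|V(G)|$ vertices, and let $k,r\ge 1$ be integers. For $f:V(G)\to\mathbb N\times\mathbb N$ let $d_f(u,v)$ be the $\ell_1$-distance between $f(u)$ and $f(v)$. A $k\times r$ grid graph embedding of $G$ is an injection $f:V(G)\to\{1,\dots,k\}\times\{1,\dots,r\}$ such that $d_f(u,v)=1$ for every edge $\{u,v\}$ of $G$; if one exists, then $G$ is called a $k\times r$ grid graph. Let $d$ be the graph distance in $G$, put $a_f=\max_{u,v\in V(G)}\bigl(d(u,v)-d_f(u,v)\bigr)$, and let $a_G=a_G(k,r)$ be the minimum of $a_f$ over all $k\times r$ grid graph embeddings $f$ of $G$ if $G$ is a $k\times r$ grid graph, and $a_G=|V(G)|$ otherwise. The problem $k\times r$-Grid Embedding asks, given $G$, $k$ and $r$, whether $G$ is a $k\times r$ grid graph. The machine model is the random access machine with uniform cost, whose arithmetic operations are addition and truncated subtraction; the input consists of $n$, $k$, $r$ and the adjacency matrix of $G$, and $a_G$ is not given. **Theorem.** $k\times r$-Grid Embedding on connected graphs is fixed-parameter tractable parameterized by $a_G+k$: some algorithm decides every instance $(G,k,r)$ in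 time at most $h(a_G+k)\cdot N^{O(1)}$, where $h:\mathbb N\to\mathbb N$ is a computable function and $N$ is the size of the input in bits. More precisely, there are an algorithm and a constant $c$ such that the algorithm decides every instance $(G,k,r)$ in time at most $$c\cdot n^2\cdot\bigl(k\cdot\max(1,a_G)\bigr)^{c\,(k\,a_G+k^2)} .$$ -/

import Mathlib

/-! ### Random access machines with uniform cost

Programs work on finitely many integer variables and finitely many unbounded integer arrays.
The only arithmetic operations are addition and (truncated) subtraction, and every operation,
memory access, assignment and test costs one time unit. -/

namespace RAM

/-- Memory: the values of the variables, and the cells of the arrays. -/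
structure State where
  var : ℕ → ℕ
  arr : ℕ → ℕ → ℕ

/-- Expressions; `get a e` reads the cell of the array `a` whose index is the value of `e`. -/
inductive Expr where
  | const (m : ℕ)
  | var (x : ℕ)
  | get (a : ℕ) (e : Expr)
  | add (e₁ e₂ : Expr)
  | sub (e₁ e₂ : Expr)

/-- The value of an expression. -/
def Expr.eval (s : State) : Expr → ℕ
  | .const m => m
  | .var x => s.var x
  | .get a e => s.arr a (e.eval s)
  | .add e₁ e₂ => e₁.eval s + e₂.eval s
  | .sub e₁ e₂ => e₁.eval s - e₂.eval s

/-- The time for evaluating an expression: one unit for each of its nodes. -/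
def Expr.cost : Expr → ℕ
  | .const _ => 1
  | .var _ => 1
  | .get _ e => e.cost + 1
  | .add e₁ e₂ => e₁.cost + e₂.cost + 1
  | .sub e₁ e₂ => e₁.cost + e₂.cost + 1

/-- Programs. A test succeeds when the value of its expression is not `0`. -/
inductive Prog where
  | skip
  | assign (x : ℕ) (e : Expr)
  | put (a : ℕ) (i e : Expr)
  | seq (p q : Prog)
  | cond (b : Expr) (p q : Prog)
  | loop (b : Expr) (p : Prog)

/-- Assignment to a variable. -/
def State.assign (s : State) (x m : ℕ) : State :=
  { s with var := Function.update s.var x m }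

/-- Assignment to an array cell. -/
def State.put (s : State) (a i m : ℕ) : State :=
  { s with arr := Function.update s.arr a (Function.update (s.arr a) i m) }

/-- `Exec p s s' t`: started in `s`, the program `p` halts in `s'` after exactly `t` time units. -/
inductive Exec : Prog → State → State → ℕ → Prop
  | skip (s : State) : Exec .skip s s 1
  | assign (s : State) (x : ℕ) (e : Expr) :
      Exec (.assign x e) s (s.assign x (e.eval s)) (e.cost + 1)
  | put (s : State) (a : ℕ) (i e : Expr) :
      Exec (.put a i e) s (s.put a (i.eval s) (e.eval s)) (i.cost + e.cost + 1)
  | seq {p q : Prog} {s s₁ s₂ : State} {t₁ t₂ : ℕ} :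
      Exec p s s₁ t₁ → Exec q s₁ s₂ t₂ → Exec (.seq p q) s s₂ (t₁ + t₂)
  | cond_true {b : Expr} {p q : Prog} {s s' : State} {t : ℕ} :
      b.eval s ≠ 0 → Exec p s s' t → Exec (.cond b p q) s s' (b.cost + 1 + t)
  | cond_false {b : Expr} {p q : Prog} {s s' : State} {t : ℕ} :
      b.eval s = 0 → Exec q s s' t → Exec (.cond b p q) s s' (b.cost + 1 + t)
  | loop_true {b : Expr} {p : Prog} {s s₁ s₂ : State} {t₁ t₂ : ℕ} :
      b.eval s ≠ 0 → Exec p s s₁ t₁ → Exec (.loop b p) s₁ s₂ t₂ →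
        Exec (.loop b p) s s₂ (b.cost + 1 + t₁ + t₂)
  | loop_false {b : Expr} {p : Prog} {s : State} :
      b.eval s = 0 → Exec (.loop b p) s s (b.cost + 1)

/-- The program is deterministic: final state and running time depend only on the start. -/
theorem Exec.det {p : Prog} {s s₁ s₂ : State} {t₁ t₂ : ℕ}
    (h₁ : Exec p s s₁ t₁) (h₂ : Exec p s s₂ t₂) : s₁ = s₂ ∧ t₁ = t₂ := by
  induction h₁ generalizing s₂ t₂ with
  | skip => cases h₂; exact ⟨rfl, rfl⟩
  | assign => cases h₂; exact ⟨rfl, rfl⟩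
  | put => cases h₂; exact ⟨rfl, rfl⟩
  | seq _ _ ih ih' =>
    cases h₂ with
    | seq g g' =>
      obtain ⟨rfl, rfl⟩ := ih g
      obtain ⟨rfl, rfl⟩ := ih' g'
      exact ⟨rfl, rfl⟩
  | cond_true hb _ ih =>
    cases h₂ with
    | cond_true _ g => obtain ⟨rfl, rfl⟩ := ih g; exact ⟨rfl, rfl⟩
    | cond_false hb' _ => exact absurd hb' hb
  | cond_false hb _ ih =>
    cases h₂ with
    | cond_true hb' _ => exact absurd hb hb'
    | cond_false _ g => obtain ⟨rfl, rfl⟩ := ih g; exact ⟨rfl, rfl⟩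
  | loop_true hb _ _ ih ih' =>
    cases h₂ with
    | loop_true _ g g' =>
      obtain ⟨rfl, rfl⟩ := ih g
      obtain ⟨rfl, rfl⟩ := ih' g'
      exact ⟨rfl, rfl⟩
    | loop_false hb' => exact absurd hb' hb
  | loop_false hb =>
    cases h₂ with
    | loop_true hb' _ _ => exact absurd hb hb'
    | loop_false _ => exact ⟨rfl, rfl⟩

/-- Started in `s`, the program `p` halts within time `T` and its answer, left in variable `0`,
is `1` if `A` holds and `0` otherwise. -/
def DecidesWithin (p : Prog) (s : State) (A : Prop) (T : ℕ) : Prop :=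
  ∃ (s' : State) (t : ℕ), Exec p s s' t ∧ t ≤ T ∧
    ((A ∧ s'.var 0 = 1) ∨ (¬ A ∧ s'.var 0 = 0))

/-- Fixed-parameter tractability of the decision problem `L` with respect to the parameter `κ`,
for inputs presented as `encode x` and of size `size x`. One program decides all instances in
time `f (κ x) * size x ^ c` with `f` computable; the program is not given `κ x`. -/
def IsFPT {α : Type} (encode : α → State) (size : α → ℕ) (L : α → Prop) (κ : α → ℕ) : Prop :=
  ∃ (p : Prog) (f : ℕ → ℕ) (c : ℕ), Computable f ∧
    ∀ x : α, DecidesWithin p (encode x) (L x) (f (κ x) * size x ^ c)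

end RAM

/-! ### Grid graph embeddings and the distance approximation parameter -/

/-- The grid distance of `u` and `v` under `f` (rows are first coordinates). -/
def gridDist {V : Type} (f : V → ℕ × ℕ) (u v : V) : ℕ :=
  Nat.dist (f u).1 (f v).1 + Nat.dist (f u).2 (f v).2

/-- `k × r` grid graph embeddings: injections into `{1, …, k} × {1, …, r}` that place
adjacent vertices at grid distance one. -/
structure IsGridEmbedding {V : Type} (G : SimpleGraph V) (k r : ℕ) (f : V → ℕ × ℕ) : Prop where
  injective : Function.Injective f
  mem : ∀ v, f v ∈ Set.Icc 1 k ×ˢ Set.Icc 1 r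
  adj : ∀ u v, G.Adj u v → gridDist f u v = 1

/-- `k × r` grid graphs. -/
def IsGridGraph {V : Type} (G : SimpleGraph V) (k r : ℕ) : Prop :=
  ∃ f, IsGridEmbedding G k r f

/-- The distance approximation of `f`: the maximum of `d(u, v) - d_f(u, v)` over all pairs.
Pairs with `u = v` contribute `0`, so truncated subtraction does not change the maximum. -/
noncomputable def distApprox {V : Type} [Fintype V] (G : SimpleGraph V) (f : V → ℕ × ℕ) : ℕ :=
  (Finset.univ : Finset (V × V)).sup fun p => G.dist p.1 p.2 - gridDist f p.1 p.2

open Classical in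
/-- The `k × r` distance approximation parameter: the least distance approximation of a
`k × r` grid graph embedding, or the number of vertices if there is no such embedding. -/
noncomputable def distApproxParam {V : Type} [Fintype V] (G : SimpleGraph V) (k r : ℕ) : ℕ :=
  if IsGridGraph G k r then sInf {a | ∃ f, IsGridEmbedding G k r f ∧ distApprox G f = a}
  else Fintype.card V

/-- Instances: a connected graph with vertices `0, …, n - 1`, and two positive integers. -/
structure GridInstance where
  n : ℕ
  graph : SimpleGraph (Fin n)
  connected : graph.Connected
  k : ℕ
  r : ℕ
  k_pos : 0 < k
  r_pos : 0 < r

namespace GridInstance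

/-- The question of the `k × r` grid embedding problem. -/
def IsYes (I : GridInstance) : Prop := IsGridGraph I.graph I.k I.r

/-- The parameter `a_G` of an instance. -/
noncomputable def aG (I : GridInstance) : ℕ := distApproxParam I.graph I.k I.r

/-- The input size in bits: the adjacency matrix, and the binary expansions of `n`, `k`, `r`. -/
def size (I : GridInstance) : ℕ := I.n ^ 2 + Nat.size I.n + Nat.size I.k + Nat.size I.r

open Classical in
/-- The initial memory: variables `0, 1, 2` hold `n, k, r`, and array `0` holds the adjacency
matrix, row by row. Everything else is `0`. -/
noncomputable def encode (I : GridInstance) : RAM.State where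
  var x := if x = 0 then I.n else if x = 1 then I.k else if x = 2 then I.r else 0
  arr a i := if a = 0 ∧ ∃ u v : Fin I.n, i = u.val * I.n + v.val ∧ I.graph.Adj u v then 1 else 0

end GridInstance

/-! Fill the cells of the grid column by column, and check each vertex one column later, when all
four cells next to it are known. Suppose two partial fillings agree on the last two columns, and a
vertex occurs in the first but not in the second. Then the same holds for its neighbours, hence for
all vertices by connectivity; so the common columns are empty and the first filling is already
complete (`Valid.mem_of_sameWindow`). Incomplete fillings with the same window of `2k + 2` cells
therefore have the same extensions (`Valid.extends_of_sameWindow`), and the problem becomes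
reachability between windows. Breadth first search reaches every window with the fewest cells, which
is what the bound `r` on the number of columns requires (`Search.exists_node`, `Search.ans_eq_one`).

Levels, that is, distances from a fixed vertex plus one, keep the number of windows small. In an
embedding with distance approximation `a`, vertices in equal or neighbouring columns have levels
that differ by at most `a + k` (`lev_le_of_column`), and by connectivity this applies to successive
vertices of the filling (`column_le`). So the search may demand that levels of successive vertices
differ by at most `D`; all levels in a window then lie within `(2k + 2) D` of each other. The level
of a vertex fixes, up to `a + k`, how far its column is from that of the root, so few vertices have
levels in such a range (`card_near_le_of_embedding`). One vertex of a window can be chosen in `n`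
ways and the other entries in boundedly many, so the number of windows is linear in `n`
(`Search.tot_le`). Comparing new windows with all old ones gives `n ^ 2`: only boundedly many
children of a node pass the level test (`Valid.card_passes_le`), except at the at most `k + 1` nodes
without a vertex (`Search.card_empty_le`).

Since `a_G` is not given, the program tries `D = 1, 2, …` up to `n`. A filling that is accepted
yields an embedding for any `D` (`Valid.isGridGraph`), so the first success may end the loop; it
comes at the latest at `min n (a_G + k)`. If there is no embedding, all `n` rounds are run, and `a_G
= n` pays for them. -/

namespace RAM

/-! ### Expressions and a program logic with time bounds -/

namespace Expr

/-- Every nonzero value counts as true, so truncated subtraction compares numbers and `add` serves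
as disjunction. For this reason the lemmas below only tell when a value is `0`. -/
def lt (a b : Expr) : Expr := sub b a
def le (a b : Expr) : Expr := sub (add b (const 1)) a
def ne (a b : Expr) : Expr := add (sub a b) (sub b a)
def eq (a b : Expr) : Expr := sub (const 1) (ne a b)
def and (a b : Expr) : Expr := sub (const 1) (add (sub (const 1) a) (sub (const 1) b))
def not (a : Expr) : Expr := sub (const 1) a

variable (s : State) (a b : Expr)

@[simp] theorem eval_lt : (lt a b).eval s = 0 ↔ ¬ a.eval s < b.eval s := by
  simp only [lt, eval]; omega

@[simp] theorem eval_le : (le a b).eval s = 0 ↔ ¬ a.eval s ≤ b.eval s := by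
  simp only [le, eval]; omega

@[simp] theorem eval_ne : (ne a b).eval s = 0 ↔ a.eval s = b.eval s := by
  simp only [ne, eval]; omega

@[simp] theorem eval_eq : (eq a b).eval s = 0 ↔ a.eval s ≠ b.eval s := by
  simp only [eq, ne, eval]; omega

@[simp] theorem eval_and : (and a b).eval s = 0 ↔ a.eval s = 0 ∨ b.eval s = 0 := by
  simp only [and, eval]; omega

@[simp] theorem eval_not : (not a).eval s = 0 ↔ a.eval s ≠ 0 := by
  simp only [not, eval]; omega

@[simp] theorem eval_or : (add a b).eval s = 0 ↔ a.eval s = 0 ∧ b.eval s = 0 := by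
  simp only [eval]; omega

@[simp] theorem cost_lt : (lt a b).cost = a.cost + b.cost + 1 := by
  simp only [lt, cost]; omega

@[simp] theorem cost_le : (le a b).cost = a.cost + b.cost + 3 := by
  simp only [le, cost]; omega

@[simp] theorem cost_ne : (ne a b).cost = 2 * a.cost + 2 * b.cost + 3 := by
  simp only [ne, cost]; omega

@[simp] theorem cost_eq : (eq a b).cost = 2 * a.cost + 2 * b.cost + 5 := by
  simp only [eq, cost, cost_ne]; omega

@[simp] theorem cost_and : (and a b).cost = a.cost + b.cost + 7 := by
  simp only [and, cost]; omega

@[simp] theorem cost_not : (not a).cost = a.cost + 2 := by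
  simp only [not, cost]; omega

end Expr

@[simp] theorem State.var_assign (s : State) (x m y : ℕ) :
    (s.assign x m).var y = if y = x then m else s.var y := by
  simp [State.assign, Function.update_apply]

@[simp] theorem State.arr_assign (s : State) (x m : ℕ) : (s.assign x m).arr = s.arr := rfl

@[simp] theorem State.var_put (s : State) (a i m : ℕ) : (s.put a i m).var = s.var := rfl

@[simp] theorem State.arr_put (s : State) (a i m b : ℕ) :
    (s.put a i m).arr b = if b = a then Function.update (s.arr a) i m else s.arr b := by
  simp [State.put, Function.update_apply]

/-- Started in `s`, the program `p` halts within time `T` in a state that satisfies `Q`. -/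
def Runs (p : Prog) (s : State) (T : ℕ) (Q : State → Prop) : Prop :=
  ∃ (s' : State) (t : ℕ), Exec p s s' t ∧ t ≤ T ∧ Q s'

/-- Weakest precondition, where `Q` is told the time of the final state on a clock that shows `t`
at the start. -/
def Wp (p : Prog) (Q : State → ℕ → Prop) (s : State) (t : ℕ) : Prop :=
  ∃ (s' : State) (t' : ℕ), Exec p s s' t' ∧ Q s' (t + t')

variable {p q : Prog} {s : State} {t T : ℕ} {Q : State → ℕ → Prop} {P : State → Prop} {b : Expr}

theorem runs_of_wp (h : Wp p (fun s' t' => t' ≤ T ∧ P s') s 0) : Runs p s T P := by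
  obtain ⟨s', t', h, h', h''⟩ := h
  exact ⟨s', t', h, by omega, h''⟩

theorem Runs.wp (h : Runs p s T P) (hQ : ∀ s' t', P s' → t' ≤ t + T → Q s' t') : Wp p Q s t := by
  obtain ⟨s', t', h, h', h''⟩ := h
  exact ⟨s', t', h, hQ _ _ h'' (by omega)⟩

theorem Runs.mono {T' : ℕ} {P' : State → Prop} (h : Runs p s T P) (hT : T ≤ T')
    (hP : ∀ s', P s' → P' s') : Runs p s T' P' := by
  obtain ⟨s', t', h, h', h''⟩ := h
  exact ⟨s', t', h, h'.trans hT, hP _ h''⟩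

theorem Wp.skip (h : Q s (t + 1)) : Wp .skip Q s t := ⟨s, 1, .skip s, h⟩

theorem Wp.assign {x : ℕ} {e : Expr} (h : Q (s.assign x (e.eval s)) (t + (e.cost + 1))) :
    Wp (.assign x e) Q s t := ⟨_, _, .assign s x e, h⟩

theorem Wp.put {a : ℕ} {i e : Expr} (h : Q (s.put a (i.eval s) (e.eval s)) (t + (i.cost + e.cost + 1))) :
    Wp (.put a i e) Q s t := ⟨_, _, .put s a i e, h⟩

theorem Wp.seq (h : Wp p (Wp q Q) s t) : Wp (.seq p q) Q s t := by
  obtain ⟨s₁, t₁, h₁, s₂, t₂, h₂, h⟩ := h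
  exact ⟨s₂, t₁ + t₂, .seq h₁ h₂, by rwa [← add_assoc]⟩

theorem Wp.cond (h : b.eval s ≠ 0 → Wp p Q s (t + (b.cost + 1)))
    (h' : b.eval s = 0 → Wp q Q s (t + (b.cost + 1))) : Wp (.cond b p q) Q s t := by
  by_cases hb : b.eval s = 0
  · obtain ⟨s', t', g, g'⟩ := h' hb
    exact ⟨s', _, .cond_false hb g, by rwa [← add_assoc]⟩
  · obtain ⟨s', t', g, g'⟩ := h hb
    exact ⟨s', _, .cond_true hb g, by rwa [← add_assoc]⟩

/-- Loops: the first argument of the invariant bounds the remaining time. -/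
theorem Runs.loop (Inv : ℕ → State → Prop) (h : Inv T s)
    (step : ∀ T s, Inv T s → b.eval s ≠ 0 →
      Wp p (fun s' t' => ∃ T', t' + T' ≤ T ∧ Inv T' s') s (b.cost + 1))
    (exit : ∀ T s, Inv T s → b.eval s = 0 → b.cost + 1 ≤ T ∧ P s) : Runs (.loop b p) s T P := by
  -- The remaining time is itself the termination measure, because every test costs at least one
  -- unit.
  induction T using Nat.strong_induction_on generalizing s with
  | _ T ih =>
    by_cases hb : b.eval s = 0
    · exact ⟨s, _, .loop_false hb, exit _ _ h hb⟩
    · obtain ⟨s₁, t₁, h₁, T', hT, h₂⟩ := step _ _ h hb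
      obtain ⟨s₂, t₂, h₃, h₄, h₅⟩ := ih T' (by omega) h₂
      exact ⟨s₂, _, .loop_true hb h₁ h₃, by omega, h₅⟩

/-- Run `p` with `x = 0, …, e - 1`. -/
def Prog.for (x : ℕ) (e : Expr) (p : Prog) : Prog :=
  .seq (.assign x (.const 0)) (.loop (.lt (.var x) e) (.seq p (.assign x (.add (.var x) (.const 1)))))

/-- `f j` pays for the body alone. Each round adds `e.cost + 3` for the test and `4` for the
increment; the initial assignment and the last test make up `e.cost + 5`. The bound `e` is evaluated
anew in each round, so the invariant has to keep its value at `m`. -/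
theorem Runs.for {x m : ℕ} {e : Expr} (Inv : ℕ → State → Prop) (f : ℕ → ℕ)
    (init : Inv 0 (s.assign x 0))
    (he : ∀ j s, Inv j s → s.var x = j ∧ e.eval s = m)
    (step : ∀ j s, Inv j s → j < m →
      Wp p (fun s' t' => t' ≤ f j ∧ Inv (j + 1) (s'.assign x (s'.var x + 1))) s 0)
    (exit : ∀ s, Inv m s → P s) :
    Runs (Prog.for x e p) s (∑ j ∈ Finset.range m, (f j + (e.cost + 7)) + (e.cost + 5)) P := by
  apply runs_of_wp
  apply Wp.seq
  apply Wp.assign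
  have key : Runs (.loop (.lt (.var x) e) (.seq p (.assign x (.add (.var x) (.const 1)))))
      (s.assign x 0) (∑ j ∈ Finset.Ico 0 m, (f j + (e.cost + 7)) + (e.cost + 3)) P := by
    refine Runs.loop (fun T s => ∃ j ≤ m, Inv j s ∧
      T = ∑ j ∈ Finset.Ico j m, (f j + (e.cost + 7)) + (e.cost + 3)) ⟨0, by simp, init, rfl⟩ ?_ ?_
    · rintro T s ⟨j, hj, hI, rfl⟩ hb
      obtain ⟨h₁, h₂⟩ := he _ _ hI
      have hjm : j < m := by
        by_contra hc
        exact hb (by simp [Expr.eval, h₁, h₂]; omega)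
      apply Wp.seq
      obtain ⟨s', t', h₃, h₄, h₅⟩ := step j s hI hjm
      refine ⟨s', t', h₃, Wp.assign ⟨_, ?_, j + 1, hjm, h₅, rfl⟩⟩
      rw [Finset.sum_eq_sum_Ico_succ_bot hjm]
      simp only [Expr.cost, Expr.cost_lt]
      omega
    · rintro T s ⟨j, hj, hI, rfl⟩ hb
      obtain ⟨h₁, h₂⟩ := he _ _ hI
      have hjm : j = m := by
        simp [Expr.eval, h₁, h₂] at hb; omega
      subst hjm
      exact ⟨by simp [Expr.cost]; omega, exit _ hI⟩
  refine key.wp fun s' t' h h' => ⟨?_, h⟩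
  simp only [Expr.cost, Finset.range_eq_Ico] at h' ⊢
  omega

/-- The two states agree outside the variables `vs` and the arrays `as`. -/
structure Agree (vs as : List ℕ) (s s' : State) : Prop where
  var : ∀ x ∉ vs, s'.var x = s.var x
  arr : ∀ a ∉ as, s'.arr a = s.arr a

theorem Agree.refl (vs as : List ℕ) (s : State) : Agree vs as s s := ⟨fun _ _ => rfl, fun _ _ => rfl⟩

theorem Agree.trans {vs as : List ℕ} {s₁ s₂ s₃ : State} (h : Agree vs as s₁ s₂)
    (h' : Agree vs as s₂ s₃) : Agree vs as s₁ s₃ :=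
  ⟨fun x hx => (h'.var x hx).trans (h.var x hx), fun a ha => (h'.arr a ha).trans (h.arr a ha)⟩

theorem Agree.mono {vs as vs' as' : List ℕ} {s s' : State} (h : Agree vs as s s')
    (hv : vs ⊆ vs') (ha : as ⊆ as') : Agree vs' as' s s' :=
  ⟨fun x hx => h.var x fun hc => hx (hv hc), fun a hx => h.arr a fun hc => hx (ha hc)⟩

theorem Agree.assign {vs as : List ℕ} {s s' : State} (h : Agree vs as s s') {x m : ℕ}
    (hx : x ∈ vs) : Agree vs as s (s'.assign x m) :=
  ⟨fun y hy => by
    rw [State.var_assign, if_neg (by rintro rfl; exact hy hx), h.var y hy], h.arr⟩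

theorem Agree.put {vs as : List ℕ} {s s' : State} (h : Agree vs as s s') {a i m : ℕ}
    (hx : a ∈ as) : Agree vs as s (s'.put a i m) :=
  ⟨h.var, fun y hy => by
    rw [State.arr_put, if_neg (by rintro rfl; exact hy hx), h.arr y hy]⟩

end RAM

/-! ### Histories

A history lists the contents of the cells filled so far, newest first: `0` for an empty cell and
`v + 1` for the vertex `v`. The cells are filled column by column. A column has `k + 1` cells, and
the last one always remains empty, so that cells are adjacent in the grid if and only if their
indices differ by `1` or `k + 1`. -/

namespace History

open SimpleGraph

variable {n : ℕ}

/-- The adjacency of cell contents. -/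
def ContentAdj (G : SimpleGraph (Fin n)) (c d : ℕ) : Prop :=
  ∃ u v, G.Adj u v ∧ c = u.val + 1 ∧ d = v.val + 1

theorem ContentAdj.symm {G : SimpleGraph (Fin n)} {c d : ℕ} (h : ContentAdj G c d) :
    ContentAdj G d c := by
  obtain ⟨u, v, h, rfl, rfl⟩ := h
  exact ⟨v, u, h.symm, rfl, rfl⟩

/-- The row of the next cell. -/
def row (k : ℕ) : List ℕ → ℕ
  | [] => 0
  | _ :: h => if row k h = k then 0 else row k h + 1

/-- The vertex placed last, or `0`. -/
def newest : List ℕ → ℕ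
  | [] => 0
  | c :: h => if c = 0 then newest h else c

/-- The number of vertices placed. -/
def placed : List ℕ → ℕ
  | [] => 0
  | c :: h => if c = 0 then placed h else placed h + 1

/-- The number of cells since the last vertex was placed. -/
def gap : List ℕ → ℕ
  | [] => 0
  | c :: h => if c = 0 then gap h + 1 else 0

/-- A vertex `c` in the next cell respects the separating row, and its level is close to that of
the vertex placed last. -/
def Passes (k D : ℕ) (lev : ℕ → ℕ) (h : List ℕ) (c : ℕ) : Prop :=
  c = 0 ∨ row k h ≠ k ∧ (newest h = 0 ∨ lev c ≤ lev (newest h) + D ∧ lev (newest h) ≤ lev c + D)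

/-- All neighbours of the vertex one column before the newest cell are in the cells next to it. -/
def Closes (G : SimpleGraph (Fin n)) (k : ℕ) (h : List ℕ) : Prop :=
  ∀ y, ContentAdj G (h.getD (k + 1) 0) y →
    y = h.getD 0 0 ∨ y = h.getD k 0 ∨ y = h.getD (k + 2) 0 ∨ y = h.getD (2 * k + 2) 0

/-- The content `c` may be put into the next cell. -/
structure Extends (G : SimpleGraph (Fin n)) (k D : ℕ) (lev : ℕ → ℕ) (h : List ℕ) (c : ℕ) : Prop where
  le : c ≤ n
  passes : Passes k D lev h c
  fresh : c = 0 ∨ c ∉ h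
  closes : Closes G k (c :: h)

def Valid (G : SimpleGraph (Fin n)) (k D : ℕ) (lev : ℕ → ℕ) : List ℕ → Prop
  | [] => True
  | c :: h => Valid G k D lev h ∧ Extends G k D lev h c

/-- All vertices have been placed, and all their neighbours have been checked. -/
def Complete (n k : ℕ) (h : List ℕ) : Prop := n ≤ placed h ∧ k + 1 ≤ gap h

/-- The histories have the same next row and the same contents of the last two columns. -/
def SameWindow (k : ℕ) (h h' : List ℕ) : Prop :=
  row k h = row k h' ∧ ∀ i < 2 * k + 2, h.getD i 0 = h'.getD i 0

theorem SameWindow.symm {k : ℕ} {h h' : List ℕ} (H : SameWindow k h h') : SameWindow k h' h :=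
  ⟨H.1.symm, fun i hi => (H.2 i hi).symm⟩

theorem SameWindow.trans {k : ℕ} {h₁ h₂ h₃ : List ℕ} (H : SameWindow k h₁ h₂)
    (H' : SameWindow k h₂ h₃) : SameWindow k h₁ h₃ :=
  ⟨H.1.trans H'.1, fun i hi => (H.2 i hi).trans (H'.2 i hi)⟩

theorem SameWindow.cons {k : ℕ} {h h' : List ℕ} (H : SameWindow k h h') (c : ℕ) :
    SameWindow k (c :: h) (c :: h') := by
  refine ⟨by simp [row, H.1], fun i hi => ?_⟩
  cases i with
  | zero => simp
  | succ i => simpa using H.2 i (by omega)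

/-! ### Attributes of a history in terms of its entries -/

theorem row_eq (k : ℕ) (h : List ℕ) : row k h = h.length % (k + 1) := by
  induction h with
  | nil => simp [row]
  | cons c h ih =>
    rw [row, ih, List.length_cons]
    have : h.length % (k + 1) < k + 1 := Nat.mod_lt _ (Nat.succ_pos k)
    have h2 : (h.length + 1) % (k + 1) = (h.length % (k + 1) + 1) % (k + 1) := by simp [Nat.add_mod]
    rw [h2]
    split_ifs with h1
    · rw [h1]; simp
    · exact (Nat.mod_eq_of_lt (by omega)).symm

theorem placed_eq (h : List ℕ) : placed h = (h.filter (· ≠ 0)).length := by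
  induction h with
  | nil => rfl
  | cons c h ih => by_cases hc : c = 0 <;> simp [placed, hc, ih]

theorem le_gap_iff (m : ℕ) (h : List ℕ) :
    m ≤ gap h ↔ m ≤ h.length ∧ ∀ i < m, h.getD i 0 = 0 := by
  induction h generalizing m with
  | nil => simp [gap]
  | cons c h ih =>
    cases m with
    | zero => simp
    | succ m =>
      by_cases hc : c = 0
      · simp only [gap, hc, if_true, Nat.add_le_add_iff_right, ih, List.length_cons]
        refine and_congr_right fun _ => ⟨fun H i hi => ?_, fun H i hi => ?_⟩
        · cases i with
          | zero => simp
          | succ i => simpa using H i (by omega)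
        · simpa using H (i + 1) (by omega)
      · simp only [gap, hc, if_false, List.length_cons]
        exact ⟨fun H => by omega, fun H => absurd (by simpa using H.2 0 (by omega)) hc⟩

theorem newest_eq_zero {h : List ℕ} : newest h = 0 ↔ ∀ i, h.getD i 0 = 0 := by
  induction h with
  | nil => simp [newest]
  | cons c h ih =>
    by_cases hc : c = 0
    · simp only [newest, hc, if_true, ih]
      refine ⟨fun H i => ?_, fun H i => by simpa using H (i + 1)⟩
      cases i with
      | zero => simp
      | succ i => simpa using H i
    · simp only [newest, hc, if_false, false_iff]
      exact fun H => hc (by simpa using H 0)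

/-- The vertex placed last is the first nonzero entry. -/
theorem newest_spec {h : List ℕ} (H : newest h ≠ 0) :
    ∃ i < h.length, h.getD i 0 = newest h ∧ ∀ j < i, h.getD j 0 = 0 := by
  induction h with
  | nil => simp [newest] at H
  | cons c h ih =>
    by_cases hc : c = 0
    · simp only [newest, hc, if_true] at H ⊢
      obtain ⟨i, h₀, h₁, h₂⟩ := ih H
      refine ⟨i + 1, by simpa using h₀, by simpa using h₁, fun j hj => ?_⟩
      cases j with
      | zero => simp
      | succ j => simpa using h₂ j (by omega)
    · exact ⟨0, by simp, by simp [newest, hc], by simp⟩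

theorem mem_iff_getD {h : List ℕ} {c : ℕ} (hc : c ≠ 0) : c ∈ h ↔ ∃ i, h.getD i 0 = c := by
  rw [List.mem_iff_getElem]
  constructor
  · rintro ⟨i, hi, rfl⟩
    exact ⟨i, List.getD_eq_getElem _ _ hi⟩
  · rintro ⟨i, rfl⟩
    have hi : i < h.length := by
      by_contra hi
      exact hc (List.getD_eq_default _ _ (by omega))
    exact ⟨i, hi, (List.getD_eq_getElem _ _ hi).symm⟩

variable {G : SimpleGraph (Fin n)} {k D : ℕ} {lev : ℕ → ℕ} {h h' : List ℕ}

/-! ### Valid histories, and what a window determines -/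

namespace Valid

theorem le (H : Valid G k D lev h) : ∀ c ∈ h, c ≤ n := by
  induction h with
  | nil => simp
  | cons c h ih =>
    intro d hd
    rcases List.mem_cons.1 hd with rfl | hd
    · exact H.2.le
    · exact ih H.1 d hd

theorem getD_le (H : Valid G k D lev h) (i : ℕ) : h.getD i 0 ≤ n := by
  by_cases h0 : h.getD i 0 = 0
  · omega
  · exact H.le _ ((mem_iff_getD h0).2 ⟨i, rfl⟩)

theorem inj (H : Valid G k D lev h) :
    ∀ i j, h.getD i 0 = h.getD j 0 → h.getD i 0 ≠ 0 → i = j := by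
  induction h with
  | nil => simp
  | cons c h ih =>
    intro i j hij h0
    cases i with
    | zero =>
      cases j with
      | zero => rfl
      | succ j =>
        simp only [List.getD_cons_zero, List.getD_cons_succ] at hij h0
        rcases H.2.fresh with h1 | h1
        · exact absurd h1 h0
        · exact absurd ((mem_iff_getD h0).2 ⟨j, hij.symm⟩) h1
    | succ i =>
      cases j with
      | zero =>
        simp only [List.getD_cons_zero, List.getD_cons_succ] at hij h0
        rcases H.2.fresh with h1 | h1
        · exact absurd (hij.trans h1) h0
        · exact absurd ((mem_iff_getD (hij ▸ h0)).2 ⟨i, hij⟩) h1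
      | succ j =>
        simp only [List.getD_cons_succ] at hij h0
        rw [ih H.1 i j hij h0]

theorem nodup (H : Valid G k D lev h) : (h.filter (· ≠ 0)).Nodup := by
  induction h with
  | nil => simp
  | cons c h ih =>
    by_cases hc : c = 0
    · simpa [hc] using ih H.1
    · have := ih H.1
      rcases H.2.fresh with h1 | h1
      · exact absurd h1 hc
      · simp [hc, h1] at this ⊢; exact this

/-- `Closes` examined this vertex when it was exactly `k + 1` cells behind the newest cell; later
cells only shift the indices. -/
theorem closed (H : Valid G k D lev h) (i : ℕ) (hi : k + 1 ≤ i) (y : ℕ)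
    (hy : ContentAdj G (h.getD i 0) y) :
    y = h.getD (i - (k + 1)) 0 ∨ y = h.getD (i - 1) 0 ∨ y = h.getD (i + 1) 0 ∨
      y = h.getD (i + (k + 1)) 0 := by
  induction h generalizing i with
  | nil =>
    obtain ⟨u, v, -, h1, -⟩ := hy
    simp at h1
  | cons c h ih =>
    rcases Nat.lt_or_ge (k + 1) i with h1 | h1
    · obtain ⟨i, rfl⟩ : ∃ j, i = j + 1 := ⟨i - 1, by omega⟩
      have := ih H.1 i (by omega) (by simpa using hy)
      obtain ⟨i, rfl⟩ : ∃ j, i = j + (k + 1) := ⟨i - (k + 1), by omega⟩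
      have e1 : i + (k + 1) + 1 - (k + 1) = i + 1 := by omega
      have e2 : i + (k + 1) + 1 - 1 = i + k + 1 := by omega
      have e3 : i + (k + 1) + 1 + (k + 1) = (i + (k + 1) + (k + 1)) + 1 := by omega
      have e4 : i + (k + 1) - (k + 1) = i := by omega
      have e5 : i + (k + 1) - 1 = i + k := by omega
      rw [e4, e5] at this
      rw [e1, e2, e3]
      simpa only [List.getD_cons_succ] using this
    · obtain rfl : i = k + 1 := by omega
      have := H.2.closes y hy
      have e1 : k + 1 + (k + 1) = 2 * k + 2 := by omega
      simpa [e1] using this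

theorem row_ne (H : Valid G k D lev h) (i : ℕ) (hi : i < h.length) (h0 : h.getD i 0 ≠ 0) :
    (h.length - 1 - i) % (k + 1) ≠ k := by
  induction h generalizing i with
  | nil => simp at hi
  | cons c h ih =>
    cases i with
    | zero =>
      rcases H.2.passes with h1 | h1
      · exact absurd h1 (by simpa using h0)
      · simpa [row_eq] using h1.1
    | succ i =>
      have := ih H.1 i (by simpa using hi) (by simpa using h0)
      rwa [List.length_cons, show h.length + 1 - 1 - (i + 1) = h.length - 1 - i by omega]

/-- Levels change slowly along a history. -/
theorem lev_le (H : Valid G k D lev h) (i j : ℕ) (hij : i ≤ j) (hi : h.getD i 0 ≠ 0)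
    (hj : h.getD j 0 ≠ 0) :
    lev (h.getD i 0) ≤ lev (h.getD j 0) + (j - i) * D ∧
      lev (h.getD j 0) ≤ lev (h.getD i 0) + (j - i) * D := by
  induction h generalizing i j with
  | nil => simp at hi
  | cons c h ih =>
    cases j with
    | zero =>
      obtain rfl : i = 0 := by omega
      simp
    | succ j =>
      cases i with
      | succ i =>
        simp only [List.getD_cons_succ] at hi hj ⊢
        have := ih H.1 i j (by omega) hi hj
        rwa [show j + 1 - (i + 1) = j - i by omega]
      | zero =>
        simp only [List.getD_cons_succ, List.getD_cons_zero] at hi hj ⊢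
        rcases H.2.passes with h1 | ⟨-, h1⟩
        · exact absurd h1 hi
        have h2 : newest h ≠ 0 := fun h2 => hj (newest_eq_zero.1 h2 j)
        rcases h1 with h1 | h1
        · exact absurd h1 h2
        -- The new vertex is compared with the vertex placed last, at index `m`. The induction
        -- hypothesis covers the way from `m` to `j`, and the empty cells skipped only enlarge the
        -- allowance.
        obtain ⟨m, -, h3, h4⟩ := newest_spec h2
        have hm : m ≤ j := by
          by_contra hm
          exact hj (h4 j (by omega))
        have h5 := ih H.1 m j hm (by rwa [h3]) hj
        rw [h3] at h5
        have h6 : (j - m) * D + D ≤ (j + 1 - 0) * D := by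
          rw [← Nat.succ_mul]; exact Nat.mul_le_mul_right _ (by omega)
        omega

theorem complete_of_forall_mem (H : Valid G k D lev h) (hall : ∀ v : Fin n, v.val + 1 ∈ h)
    (hl : k + 1 ≤ h.length) (h0 : ∀ i < k + 1, h.getD i 0 = 0) : Complete n k h := by
  refine ⟨?_, (le_gap_iff _ _).2 ⟨hl, h0⟩⟩
  rw [placed_eq, ← List.toFinset_card_of_nodup H.nodup]
  calc n = (Finset.univ.image fun v : Fin n => v.val + 1).card := by
        rw [Finset.card_image_of_injective _ fun a b h => by simpa [Fin.ext_iff] using h]; simp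
    _ ≤ _ := Finset.card_le_card fun x hx => by
      obtain ⟨v, -, rfl⟩ := Finset.mem_image.1 hx
      simp [hall v]

/-- Pigeonhole: the nonzero entries are distinct, at most `n`, and at least `n` in number. -/
theorem mem_of_complete (H : Valid G k D lev h) (hc : Complete n k h) (v : Fin n) :
    v.val + 1 ∈ h := by
  have h1 : (h.filter (· ≠ 0)).toFinset ⊆ Finset.univ.image fun v : Fin n => v.val + 1 := by
    intro x hx
    simp only [List.mem_toFinset, List.mem_filter, decide_eq_true_eq] at hx
    have := H.le x hx.1
    exact Finset.mem_image.2 ⟨⟨x - 1, by omega⟩, Finset.mem_univ _, by simp only; omega⟩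
  have h2 := Finset.eq_of_subset_of_card_le h1 (by
    rw [List.toFinset_card_of_nodup H.nodup, ← placed_eq]
    exact (Finset.card_image_le.trans (by simp)).trans hc.1)
  have h3 : v.val + 1 ∈ (h.filter (· ≠ 0)).toFinset := by
    rw [h2]; exact Finset.mem_image.2 ⟨v, Finset.mem_univ _, rfl⟩
  simp only [List.mem_toFinset, List.mem_filter] at h3
  exact h3.1

/-- No fresh vertex is left, so only an empty cell can follow. -/
theorem complete_cons {c : ℕ} (H : Valid G k D lev (c :: h)) (hc : Complete n k h) :
    Complete n k (c :: h) := by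
  obtain rfl : c = 0 := by
    rcases H.2.fresh with h1 | h1
    · exact h1
    · by_contra h0
      have := H.2.le
      refine h1 ?_
      have := H.1.mem_of_complete hc ⟨c - 1, by omega⟩
      rwa [show c - 1 + 1 = c by omega] at this
  exact ⟨by simpa [placed] using hc.1, by simp only [gap, if_true]; exact hc.2.trans (Nat.le_succ _)⟩

/-- In a connected graph, the last two columns determine which vertices have been placed. -/
theorem mem_of_sameWindow (hG : G.Connected) (H : Valid G k D lev h) (H' : Valid G k D lev h')
    (hc : ¬ Complete n k h) (hw : SameWindow k h h') {y : ℕ} (hy : y ∈ h) (hy0 : y ≠ 0) :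
    y ∈ h' := by
  by_contra hyn
  have step : ∀ u v : Fin n, G.Adj u v → u.val + 1 ∈ h ∧ u.val + 1 ∉ h' →
      v.val + 1 ∈ h ∧ v.val + 1 ∉ h' := by
    rintro u v huv ⟨hu, hu'⟩
    obtain ⟨i, hi⟩ := (mem_iff_getD (Nat.succ_ne_zero _)).1 hu
    have hi2 : 2 * k + 2 ≤ i := by
      by_contra hlt
      exact hu' ((mem_iff_getD (Nat.succ_ne_zero _)).2 ⟨i, by rw [← hw.2 i (by omega), hi]⟩)
    have hadj : ContentAdj G (h.getD i 0) (v.val + 1) := ⟨u, v, huv, hi, rfl⟩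
    -- All cells next to index `i ≥ 2k + 2` have index at least `k + 1`, so `v` lies outside the
    -- newest column of `h`.
    obtain ⟨i', hi', hv⟩ : ∃ i', k + 1 ≤ i' ∧ h.getD i' 0 = v.val + 1 := by
      rcases H.closed i (by omega) _ hadj with h1 | h1 | h1 | h1
      · exact ⟨_, by omega, h1.symm⟩
      · exact ⟨_, by omega, h1.symm⟩
      · exact ⟨_, by omega, h1.symm⟩
      · exact ⟨_, by omega, h1.symm⟩
    refine ⟨(mem_iff_getD (Nat.succ_ne_zero _)).2 ⟨i', hv⟩, fun hv' => ?_⟩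
    -- If `v` occurred in `h'` among the newest `k + 1` cells, it would also occur there in `h`,
    -- hence twice. If it occurred further back, its neighbours would have been checked, and `u`
    -- would be in `h'`.
    obtain ⟨j, hj⟩ := (mem_iff_getD (Nat.succ_ne_zero _)).1 hv'
    rcases Nat.lt_or_ge j (k + 1) with hjk | hjk
    · have h1 := hw.2 j (by omega)
      have := H.inj i' j (by rw [hv, h1, hj]) (by rw [hv]; omega)
      omega
    · have hadj' : ContentAdj G (h'.getD j 0) (u.val + 1) := ⟨v, u, huv.symm, hj, rfl⟩
      apply hu'
      rcases H'.closed j hjk _ hadj' with h1 | h1 | h1 | h1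
      all_goals exact (mem_iff_getD (Nat.succ_ne_zero _)).2 ⟨_, h1.symm⟩
  obtain ⟨u₀, rfl⟩ : ∃ u : Fin n, y = u.val + 1 := by
    have := H.le y hy
    exact ⟨⟨y - 1, by omega⟩, by simp only; omega⟩
  have all : ∀ v : Fin n, v.val + 1 ∈ h ∧ v.val + 1 ∉ h' := by
    intro v
    obtain ⟨p⟩ := hG.preconnected u₀ v
    have : ∀ {a b : Fin n}, G.Walk a b → (a.val + 1 ∈ h ∧ a.val + 1 ∉ h') →
        (b.val + 1 ∈ h ∧ b.val + 1 ∉ h') := by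
      intro a b p
      induction p with
      | nil => exact id
      | cons hab _ ih => exact fun H => ih (step _ _ hab H)
    exact this p ⟨hy, hyn⟩
  -- A vertex in the common window would belong to `h'`, which contains none; so the window is empty
  -- and `h` is complete.
  have hzero : ∀ i < 2 * k + 2, h.getD i 0 = 0 := by
    intro i hi
    by_contra h0
    have hle := H.getD_le i
    have := (all ⟨h.getD i 0 - 1, by omega⟩).2
    simp only [show h.getD i 0 - 1 + 1 = h.getD i 0 by omega] at this
    exact this ((mem_iff_getD h0).2 ⟨i, (hw.2 i hi).symm⟩)
  obtain ⟨i, hi⟩ := (mem_iff_getD hy0).1 hy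
  have hi2 : 2 * k + 2 ≤ i := by
    by_contra hlt
    exact hy0 (by rw [← hi, hzero i (by omega)])
  have hil : i < h.length := by
    by_contra hlt
    exact hy0 (by rw [← hi, List.getD_eq_default _ _ (by omega)])
  exact hc (H.complete_of_forall_mem (fun v => (all v).1) (by omega) fun j hj => hzero j (by omega))

/-- Histories with the same window have the same extensions. -/
theorem extends_of_sameWindow (hG : G.Connected) (H : Valid G k D lev h) (H' : Valid G k D lev h')
    (hc : ¬ Complete n k h) (hc' : ¬ Complete n k h') (hw : SameWindow k h h') {c : ℕ}
    (he : Extends G k D lev h c) : Extends G k D lev h' c := by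
  have hmem : ∀ y, y ≠ 0 → (y ∈ h ↔ y ∈ h') := fun y hy =>
    ⟨fun h1 => H.mem_of_sameWindow hG H' hc hw h1 hy,
      fun h1 => H'.mem_of_sameWindow hG H hc' hw.symm h1 hy⟩
  refine ⟨he.le, ?_, ?_, ?_⟩
  · rcases he.passes with h1 | ⟨h1, h2⟩
    · exact Or.inl h1
    refine Or.inr ⟨hw.1 ▸ h1, ?_⟩
    suffices newest h' = newest h by rwa [this]
    by_cases hz : ∀ i < 2 * k + 2, h.getD i 0 = 0
    · -- an empty window means that nothing has been placed
      have key : ∀ {g : List ℕ}, Valid G k D lev g → ¬ Complete n k g →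
          (∀ i < 2 * k + 2, g.getD i 0 = 0) → newest g = 0 := by
        intro g Hg hcg hzg
        by_contra h0
        obtain ⟨i, -, h3, h4⟩ := newest_spec h0
        -- The second history consists of empty cells only and has the same next row. A vertex in
        -- `g` would have to occur in it.
        have := Hg.mem_of_sameWindow (h' := List.replicate (row k g) 0) hG (k := k) ?_ hcg ?_
          ((mem_iff_getD h0).2 ⟨i, h3⟩) h0
        · exact h0 (List.eq_of_mem_replicate this)
        · generalize row k g = m
          induction m with
          | zero => trivial
          | succ m ih =>
            refine ⟨ih, by omega, Or.inl rfl, Or.inl rfl, ?_⟩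
            rintro y ⟨u, v, -, h5, -⟩
            exfalso
            have : (0 :: List.replicate m 0).getD (k + 1) 0 = 0 := by
              simp
            exact absurd (this.symm.trans h5) (by omega)
        · refine ⟨?_, fun j hj => by rw [hzg j hj]; simp⟩
          rw [row_eq k (List.replicate _ _), List.length_replicate, row_eq]; simp
      rw [key H hc hz, key H' hc' fun i hi => by rw [← hw.2 i hi, hz i hi]]
    · push Not at hz
      obtain ⟨i, hi, h0⟩ := hz
      have h3 : newest h ≠ 0 := fun h3 => h0 (newest_eq_zero.1 h3 i)
      have h3' : newest h' ≠ 0 := fun h3 => h0 (by rw [hw.2 i hi]; exact newest_eq_zero.1 h3 i)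
      obtain ⟨j, -, h4, h5⟩ := newest_spec h3
      obtain ⟨j', -, h4', h5'⟩ := newest_spec h3'
      have hji : j ≤ i := by
        by_contra hlt
        exact h0 (h5 i (by omega))
      have hj : j' = j := by
        rcases Nat.lt_trichotomy j' j with hlt | h | hlt
        · exact absurd (h4'.symm.trans ((hw.2 j' (by omega)).symm.trans (h5 j' hlt))) h3'
        · exact h
        · exact absurd (h4.symm.trans ((hw.2 j (by omega)).trans (h5' j hlt))) h3
      rw [← h4, ← h4', hj, hw.2 j (by omega)]
  · rcases he.fresh with h1 | h1
    · exact Or.inl h1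
    · by_cases hc0 : c = 0
      · exact Or.inl hc0
      · exact Or.inr fun h2 => h1 ((hmem c hc0).2 h2)
  · have := he.closes
    unfold Closes at this ⊢
    simp only [List.getD_cons_succ, List.getD_cons_zero] at this ⊢
    -- This entry is not rewritten to an entry of `h`, because for `k = 0` it is the new cell
    -- itself.
    have e : (c :: h).getD k 0 = (c :: h').getD k 0 := (hw.cons c).2 k (by omega)
    rw [← hw.2 k (by omega), ← hw.2 (k + 1) (by omega), ← hw.2 (2 * k + 1) (by omega), ← e]
    exact this

end Valid

end History

/-! ### Histories and embeddings -/

namespace History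

open SimpleGraph

variable {n : ℕ} {G : SimpleGraph (Fin n)} {k D r : ℕ} {lev : ℕ → ℕ} {h : List ℕ}

/-- The position in the grid of the cell with index `p`. -/
def cell (k p : ℕ) : ℕ × ℕ := (p % (k + 1) + 1, p / (k + 1) + 1)

theorem gridDist_eq {V : Type} (f : V → ℕ × ℕ) (u v : V) :
    gridDist f u v = ((f u).1 - (f v).1 + ((f v).1 - (f u).1)) +
      ((f u).2 - (f v).2 + ((f v).2 - (f u).2)) := rfl

theorem cell_succ {p : ℕ} (hp : p % (k + 1) ≠ k) :
    cell k (p + 1) = ((cell k p).1 + 1, (cell k p).2) := by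
  have h1 : p % (k + 1) < k + 1 := Nat.mod_lt _ (Nat.succ_pos k)
  have h2 : p % (k + 1) + 1 < k + 1 := by omega
  have h3 : p + 1 = (k + 1) * (p / (k + 1)) + (p % (k + 1) + 1) := by
    rw [← add_assoc, Nat.div_add_mod]
  have h4 : (p + 1) % (k + 1) = p % (k + 1) + 1 := by
    conv_lhs => rw [h3]
    rw [Nat.mul_add_mod, Nat.mod_eq_of_lt h2]
  have h5 : (p + 1) / (k + 1) = p / (k + 1) := by
    conv_lhs => rw [h3]
    rw [Nat.mul_add_div (by omega), Nat.div_eq_of_lt h2, add_zero]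
  simp only [cell, h4, h5]

theorem cell_add (p : ℕ) : cell k (p + (k + 1)) = ((cell k p).1, (cell k p).2 + 1) := by
  simp [cell, Nat.add_div_right _ (Nat.succ_pos k)]

theorem cell_injective : Function.Injective (cell k) := by
  intro p q hpq
  simp only [cell, Prod.mk.injEq, Nat.add_right_cancel_iff] at hpq
  rw [← Nat.div_add_mod p (k + 1), ← Nat.div_add_mod q (k + 1), hpq.1, hpq.2]

/-- A complete history of the right length is an embedding. -/
theorem Valid.isGridGraph (H : Valid G k D lev h) (hc : Complete n k h)
    (hl : h.length < (r + 1) * (k + 1)) : IsGridGraph G k r := by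
  have hex : ∀ v : Fin n, ∃ i, h.getD i 0 = v.val + 1 := fun v =>
    (mem_iff_getD (Nat.succ_ne_zero _)).1 (H.mem_of_complete hc v)
  choose i hi using hex
  have hlen : ∀ v, i v < h.length := fun v => by
    by_contra hlt
    have := hi v
    rw [List.getD_eq_default _ _ (by omega)] at this
    omega
  have hgap : ∀ v, k + 1 ≤ i v := fun v => by
    by_contra hlt
    have := ((le_gap_iff _ _).1 hc.2).2 (i v) (by omega)
    rw [hi v] at this
    omega
  have hrow : ∀ v, (h.length - 1 - i v) % (k + 1) ≠ k := fun v =>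
    H.row_ne (i v) (hlen v) (by rw [hi v]; omega)
  refine ⟨fun v => cell k (h.length - 1 - i v), ?_, ?_, ?_⟩
  · intro u v huv
    have h1 := cell_injective huv
    have h2 : i u = i v := by have := hlen u; have := hlen v; omega
    have := hi u
    rw [h2, hi v] at this
    exact Fin.ext (by omega)
  · intro v
    have h1 : (h.length - 1 - i v) % (k + 1) < k + 1 := Nat.mod_lt _ (Nat.succ_pos k)
    have h2 := hrow v
    -- The last `k + 1` cells are empty, which reduces the bound `r + 1` on the columns to `r`.
    have h3 : (h.length - 1 - i v) / (k + 1) < r := by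
      have hk : 0 < k + 1 := Nat.succ_pos k
      rw [Nat.div_lt_iff_lt_mul hk]
      have := hgap v
      have hr : (r + 1) * (k + 1) = r * (k + 1) + (k + 1) := Nat.succ_mul _ _
      have := hlen v
      omega
    simp only [cell, Set.mem_prod, Set.mem_Icc]
    generalize (h.length - 1 - i v) % (k + 1) = x at *
    generalize (h.length - 1 - i v) / (k + 1) = y at *
    omega
  · have right : ∀ u v : Fin n, i u = i v + (k + 1) →
        gridDist (fun v => cell k (h.length - 1 - i v)) u v = 1 := by
      intro u v huv
      have := hlen u
      rw [gridDist_eq]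
      simp only [show h.length - 1 - i v = h.length - 1 - i u + (k + 1) by omega, cell_add]
      omega
    have down : ∀ u v : Fin n, i u = i v + 1 →
        gridDist (fun v => cell k (h.length - 1 - i v)) u v = 1 := by
      intro u v huv
      have := hlen u
      rw [gridDist_eq]
      simp only [show h.length - 1 - i v = h.length - 1 - i u + 1 by omega, cell_succ (hrow u)]
      omega
    have comm : ∀ (f : Fin n → ℕ × ℕ) (u v : Fin n), gridDist f u v = gridDist f v u := by
      intro f u v
      rw [gridDist_eq, gridDist_eq]
      omega
    intro u v huv
    have key : ∀ j, v.val + 1 = h.getD j 0 → i v = j := fun j hj =>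
      H.inj _ _ ((hi v).trans hj) (by rw [hi v]; omega)
    have := hgap u
    rcases H.closed (i u) (hgap u) (v.val + 1) ⟨u, v, huv, hi u, rfl⟩ with h1 | h1 | h1 | h1
    · exact right u v (by have := key _ h1; omega)
    · exact down u v (by have := key _ h1; omega)
    · rw [comm]; exact down v u (by have := key _ h1; omega)
    · rw [comm]; exact right v u (by have := key _ h1; omega)

/-! #### The history of an embedding -/

/-- The index of the cell of a vertex. -/
def index (k : ℕ) (f : Fin n → ℕ × ℕ) (v : Fin n) : ℕ := ((f v).2 - 1) * (k + 1) + ((f v).1 - 1)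

open Classical in
/-- The content of a cell. -/
noncomputable def content (k : ℕ) (f : Fin n → ℕ × ℕ) (p : ℕ) : ℕ :=
  if h : ∃ v, index k f v = p then h.choose.val + 1 else 0

noncomputable def ofEmbedding (k : ℕ) (f : Fin n → ℕ × ℕ) : ℕ → List ℕ
  | 0 => []
  | t + 1 => content k f t :: ofEmbedding k f t

section
variable {f : Fin n → ℕ × ℕ}

theorem length_ofEmbedding (t : ℕ) : (ofEmbedding k f t).length = t := by
  induction t with
  | zero => rfl
  | succ t ih => simp [ofEmbedding, ih]

theorem getD_ofEmbedding (t i : ℕ) :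
    (ofEmbedding k f t).getD i 0 = if i < t then content k f (t - 1 - i) else 0 := by
  induction t generalizing i with
  | zero => simp [ofEmbedding]
  | succ t ih =>
    cases i with
    | zero => simp [ofEmbedding]
    | succ i =>
      simp only [ofEmbedding, List.getD_cons_succ, ih]
      simp [show t - (i + 1) = t - 1 - i by omega]

variable (hf : IsGridEmbedding G k r f)
include hf

theorem index_mod (v : Fin n) : index k f v % (k + 1) = (f v).1 - 1 := by
  have := hf.mem v
  simp only [Set.mem_prod, Set.mem_Icc] at this
  rw [index, Nat.mul_add_mod_of_lt (by omega)]

theorem index_injective : Function.Injective (index k f) := by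
  intro u v huv
  have h1 := index_mod hf u
  rw [huv, index_mod hf v] at h1
  have hu := hf.mem u
  have hv := hf.mem v
  simp only [Set.mem_prod, Set.mem_Icc] at hu hv
  simp only [index, h1] at huv
  have h2 := Nat.eq_of_mul_eq_mul_right (Nat.succ_pos k) (Nat.add_right_cancel huv)
  exact hf.injective (Prod.ext (by omega) (by omega))

theorem content_index (v : Fin n) : content k f (index k f v) = v.val + 1 := by
  have h : ∃ u, index k f u = index k f v := ⟨v, rfl⟩
  rw [content, dif_pos h, index_injective hf h.choose_spec]

omit hf in
theorem content_ne_zero {p : ℕ} (h : content k f p ≠ 0) : ∃ v, index k f v = p := by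
  by_contra h1
  exact h (by rw [content, dif_neg h1])

theorem content_eq {p : ℕ} {v : Fin n} (h : content k f p = v.val + 1) : index k f v = p := by
  obtain ⟨u, rfl⟩ := content_ne_zero (by rw [h]; omega)
  rw [content_index hf] at h
  rw [Fin.ext (by omega : u.val = v.val)]

theorem index_adj {u v : Fin n} (huv : G.Adj u v) :
    index k f v = index k f u + 1 ∨ index k f u = index k f v + 1 ∨
      index k f v = index k f u + (k + 1) ∨ index k f u = index k f v + (k + 1) := by
  have h := hf.adj u v huv
  rw [gridDist_eq] at h
  have hu := hf.mem u
  have hv := hf.mem v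
  simp only [Set.mem_prod, Set.mem_Icc] at hu hv
  simp only [index]
  rcases Nat.lt_trichotomy (f u).2 (f v).2 with h1 | h1 | h1
  · rw [show (f v).2 - 1 = (f u).2 - 1 + 1 by omega, Nat.succ_mul]
    omega
  · rw [h1]
    omega
  · rw [show (f u).2 - 1 = (f v).2 - 1 + 1 by omega, Nat.succ_mul]
    omega

/-- In a connected graph no column between two vertices is empty. -/
theorem column_le (hG : G.Connected) {u v : Fin n} (huv : index k f u < index k f v)
    (hno : ∀ w, ¬ (index k f u < index k f w ∧ index k f w < index k f v)) :
    (f u).2 ≤ (f v).2 ∧ (f v).2 ≤ (f u).2 + 1 := by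
  have lt_of : ∀ a b, (f a).2 < (f b).2 → index k f a < index k f b := by
    intro a b hab
    have ha := hf.mem a
    have hb := hf.mem b
    simp only [Set.mem_prod, Set.mem_Icc] at ha hb
    simp only [index]
    calc ((f a).2 - 1) * (k + 1) + ((f a).1 - 1) < ((f a).2 - 1 + 1) * (k + 1) := by
          rw [Nat.succ_mul]; omega
      _ ≤ ((f b).2 - 1) * (k + 1) := Nat.mul_le_mul_right _ (by omega)
      _ ≤ _ := Nat.le_add_right _ _
  refine ⟨?_, ?_⟩
  · by_contra hlt
    have := lt_of v u (by omega)
    omega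
  · by_contra hlt
    -- The column after that of `u` would contain no vertex, and no edge can jump over it.
    have step : ∀ a b, G.Adj a b → (f a).2 ≤ (f u).2 → (f b).2 ≤ (f u).2 := by
      intro a b hab ha
      have h := hf.adj a b hab
      rw [gridDist_eq] at h
      by_contra hb
      exact hno b ⟨lt_of u b (by omega), lt_of b v (by omega)⟩
    have walk : ∀ {a b : Fin n}, G.Walk a b → (f a).2 ≤ (f u).2 → (f b).2 ≤ (f u).2 := by
      intro a b p
      induction p with
      | nil => exact id
      | cons hab _ ih => exact fun H => ih (step _ _ hab H)
    obtain ⟨p⟩ := hG.preconnected u v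
    have := walk p le_rfl
    omega

/-- The number `t` is arbitrary, since cells without a vertex have content `0`. Assuming `hD` for
equal or neighbouring columns suffices, because `column_le` places successive vertices in such
columns. -/
theorem valid_ofEmbedding (hG : G.Connected)
    (hD : ∀ u v, (f u).2 ≤ (f v).2 + 1 → (f v).2 ≤ (f u).2 + 1 →
      lev (u.val + 1) ≤ lev (v.val + 1) + D) (t : ℕ) :
    Valid G k D lev (ofEmbedding k f t) := by
  induction t with
  | zero => trivial
  | succ t ih =>
    refine ⟨ih, ?_, ?_, ?_, ?_⟩
    · by_cases h0 : content k f t = 0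
      · omega
      · obtain ⟨v, rfl⟩ := content_ne_zero h0
        rw [content_index hf]
        omega
    · by_cases h0 : content k f t = 0
      · exact Or.inl h0
      obtain ⟨v, rfl⟩ := content_ne_zero h0
      have hv := hf.mem v
      simp only [Set.mem_prod, Set.mem_Icc] at hv
      refine Or.inr ⟨?_, ?_⟩
      · rw [row_eq, length_ofEmbedding, index_mod hf]
        omega
      by_cases h1 : newest (ofEmbedding k f (index k f v)) = 0
      · exact Or.inl h1
      right
      obtain ⟨i, h2, h3, h4⟩ := newest_spec h1
      rw [length_ofEmbedding] at h2
      rw [← h3] at h1 ⊢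
      rw [getD_ofEmbedding, if_pos h2] at h1 ⊢
      obtain ⟨u, hu⟩ := content_ne_zero h1
      have hcol := column_le hf hG (u := u) (v := v) (by omega) (by
        rintro w ⟨hw1, hw2⟩
        have := h4 (index k f v - 1 - index k f w) (by omega)
        rw [getD_ofEmbedding, if_pos (by omega),
          show index k f v - 1 - (index k f v - 1 - index k f w) = index k f w by omega,
          content_index hf] at this
        omega)
      rw [← hu, content_index hf, content_index hf]
      exact ⟨hD v u (by omega) (by omega), hD u v (by omega) (by omega)⟩
    · by_cases h0 : content k f t = 0
      · exact Or.inl h0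
      refine Or.inr fun h1 => ?_
      obtain ⟨i, hi⟩ := (mem_iff_getD h0).1 h1
      rw [getD_ofEmbedding] at hi
      split_ifs at hi with h2
      · obtain ⟨v, hv⟩ := content_ne_zero h0
        rw [← hv, content_index hf, hv] at hi
        have := content_eq hf hi
        omega
      · exact h0 hi.symm
    · change Closes G k (ofEmbedding k f (t + 1))
      rintro y ⟨u, v, huv, hu, rfl⟩
      simp only [getD_ofEmbedding] at hu ⊢
      split_ifs at hu with h1
      · have h2 := content_eq hf hu
        rcases index_adj hf huv with h3 | h3 | h3 | h3
        · right; left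
          rw [if_pos (by omega), show t + 1 - 1 - k = index k f v by omega, content_index hf]
        · right; right; left
          rw [if_pos (by omega), show t + 1 - 1 - (k + 2) = index k f v by omega, content_index hf]
        · left
          rw [if_pos (by omega), show t + 1 - 1 - 0 = index k f v by omega, content_index hf]
        · right; right; right
          rw [if_pos (by omega), show t + 1 - 1 - (2 * k + 2) = index k f v by omega,
            content_index hf]

/-- The separator at the end of column `r` is empty, so all indices are at most `r * (k + 1) - 2`,
and of the first `(r + 1) * (k + 1) - 1` cells the last `k + 1` are empty. This is the greatest
length that `Valid.isGridGraph` admits. -/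
theorem complete_ofEmbedding (hG : G.Connected)
    (hD : ∀ u v, (f u).2 ≤ (f v).2 + 1 → (f v).2 ≤ (f u).2 + 1 →
      lev (u.val + 1) ≤ lev (v.val + 1) + D) :
    Complete n k (ofEmbedding k f ((r + 1) * (k + 1) - 1)) := by
  have hlt : ∀ v, index k f v + 1 < r * (k + 1) := by
    intro v
    have hv := hf.mem v
    simp only [Set.mem_prod, Set.mem_Icc] at hv
    calc index k f v + 1 < ((f v).2 - 1 + 1) * (k + 1) := by
          rw [index, Nat.succ_mul]; omega
      _ ≤ r * (k + 1) := Nat.mul_le_mul_right _ (by omega)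
  have hr : (r + 1) * (k + 1) = r * (k + 1) + (k + 1) := Nat.succ_mul _ _
  have v₀ : Fin n := hG.nonempty.some
  have h0 := hlt v₀
  refine (valid_ofEmbedding hf hG hD _).complete_of_forall_mem ?_ ?_ ?_
  · intro v
    have := hlt v
    refine (mem_iff_getD (Nat.succ_ne_zero _)).2 ⟨(r + 1) * (k + 1) - 2 - index k f v, ?_⟩
    rw [getD_ofEmbedding, if_pos (by omega)]
    refine Eq.trans ?_ (content_index hf v)
    congr 1
    omega
  · rw [length_ofEmbedding]
    omega
  · intro i hi
    by_contra h1
    rw [getD_ofEmbedding, if_pos (by omega)] at h1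
    obtain ⟨v, hv⟩ := content_ne_zero h1
    have := hlt v
    omega

end

/-! #### Levels -/

/-- The contents with level close to that of `x`. -/
def near (n : ℕ) (lev : ℕ → ℕ) (R x : ℕ) : Finset ℕ :=
  (Finset.Icc 1 n).filter fun y => lev x ≤ lev y + R ∧ lev y ≤ lev x + R

theorem near_mono {R R' : ℕ} (h : R ≤ R') (x : ℕ) : near n lev R x ⊆ near n lev R' x := by
  intro y hy
  simp only [near, Finset.mem_filter] at hy ⊢
  exact ⟨hy.1, by omega, by omega⟩

theorem card_near_le (R x : ℕ) : (near n lev R x).card ≤ n :=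
  (Finset.card_filter_le _ _).trans (by simp)

variable {f : Fin n → ℕ × ℕ}

theorem gridDist_triangle {V : Type} (f : V → ℕ × ℕ) (u v w : V) :
    gridDist f u w ≤ gridDist f u v + gridDist f v w := by
  simp only [gridDist_eq]
  omega

theorem gridDist_le_dist (hG : G.Connected) (hf : IsGridEmbedding G k r f) (u v : Fin n) :
    gridDist f u v ≤ G.dist u v := by
  obtain ⟨p, hp⟩ := hG.exists_walk_length_eq_dist u v
  rw [← hp]
  have : ∀ {a b : Fin n} (p : G.Walk a b), gridDist f a b ≤ p.length := by
    intro a b p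
    induction p with
    | nil => simp [gridDist_eq]
    | @cons x y z hab q ih =>
      rw [Walk.length_cons]
      have h1 := hf.adj _ _ hab
      have h2 := gridDist_triangle f x y z
      omega
  exact this p

theorem dist_le_gridDist_add (f : Fin n → ℕ × ℕ) (u v : Fin n) :
    G.dist u v ≤ gridDist f u v + distApprox G f := by
  have := Finset.le_sup (f := fun p : Fin n × Fin n => G.dist p.1 p.2 - gridDist f p.1 p.2)
    (Finset.mem_univ (u, v))
  simp only at this
  unfold distApprox
  omega

/-- Vertices in neighbouring columns have close levels. -/
theorem lev_le_of_column (hG : G.Connected) (hf : IsGridEmbedding G k r f) {s : Fin n}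
    (hlev : ∀ v : Fin n, lev (v.val + 1) = G.dist s v + 1) {u v : Fin n}
    (h : (f u).2 ≤ (f v).2 + 1) (h' : (f v).2 ≤ (f u).2 + 1) :
    lev (u.val + 1) ≤ lev (v.val + 1) + (distApprox G f + k) := by
  rw [hlev, hlev]
  have h1 := hG.dist_triangle (u := s) (v := v) (w := u)
  -- The grid distance is at most `k - 1` from the rows plus `1` from the columns.
  have h2 := dist_le_gridDist_add (G := G) f v u
  rw [gridDist_eq] at h2
  have hu := hf.mem u
  have hv := hf.mem v
  simp only [Set.mem_prod, Set.mem_Icc] at hu hv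
  omega

/-- Few vertices of an embedded graph have levels in a given range. -/
theorem card_near_le_of_embedding (hG : G.Connected) (hf : IsGridEmbedding G k r f) {s : Fin n}
    (hlev : ∀ v : Fin n, lev (v.val + 1) = G.dist s v + 1) (R x : ℕ) (hx : x ∈ Finset.Icc 1 n) :
    (near n lev R x).card ≤ k * (2 * (2 * R + distApprox G f + k + 1)) := by
  obtain ⟨x, rfl⟩ : ∃ v : Fin n, x = v.val + 1 := by
    rw [Finset.mem_Icc] at hx
    exact ⟨⟨x - 1, by omega⟩, by simp only; omega⟩
  -- The columns of `v` and `s` differ by at most `d(s, v)` and by at least `d(s, v)` minus the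
  -- distance approximation and `k`. So the column of `v` lies in one of two intervals, on either
  -- side of `s`.
  set lo := G.dist s x - R - distApprox G f - k
  set hi := G.dist s x + R
  set C := Finset.Icc ((f s).2 + lo) ((f s).2 + hi) ∪ Finset.Icc ((f s).2 - hi) ((f s).2 - lo)
  have hC : C.card ≤ 2 * (2 * R + distApprox G f + k + 1) := by
    refine (Finset.card_union_le _ _).trans ?_
    rw [Nat.card_Icc, Nat.card_Icc]
    omega
  have hsub : near n lev R (x.val + 1) ⊆
      ((Finset.univ.filter fun v : Fin n => f v ∈ Finset.Icc 1 k ×ˢ C).image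
        fun v => v.val + 1) := by
    intro y hy
    simp only [near, Finset.mem_filter, Finset.mem_Icc] at hy
    obtain ⟨v, rfl⟩ : ∃ v : Fin n, y = v.val + 1 :=
      ⟨⟨y - 1, by omega⟩, by simp only; omega⟩
    refine Finset.mem_image.2 ⟨v, ?_, rfl⟩
    rw [hlev, hlev] at hy
    have h1 := gridDist_le_dist hG hf s v
    have h2 := dist_le_gridDist_add (G := G) f s v
    rw [gridDist_eq] at h1 h2
    have hs := hf.mem s
    have hv := hf.mem v
    simp only [Set.mem_prod, Set.mem_Icc] at hs hv
    simp only [Finset.mem_filter, Finset.mem_univ, true_and, Finset.mem_product, Finset.mem_Icc, C,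
      Finset.mem_union]
    omega
  calc (near n lev R (x.val + 1)).card ≤ _ := Finset.card_le_card hsub
    _ ≤ _ := Finset.card_image_le
    _ ≤ (Finset.Icc 1 k ×ˢ C).card := Finset.card_le_card_of_injOn f (by
        intro v hv
        simpa using hv) hf.injective.injOn
    _ = k * C.card := by simp
    _ ≤ _ := Nat.mul_le_mul_left _ hC

end History

/-! ### Breadth first search through the windows of histories -/

namespace History

open SimpleGraph

variable {n : ℕ} {G : SimpleGraph (Fin n)} {k D r : ℕ} {lev : ℕ → ℕ} {h h' : List ℕ}

/-- Both histories contain the same vertices, and the empty last column is visible in the window.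
The second history is long enough to have `k + 1` last cells because it contains a vertex that is
not among them. -/
theorem Valid.complete_cons_of_sameWindow (hG : G.Connected) {c : ℕ}
    (H : Valid G k D lev h) (H' : Valid G k D lev (c :: h'))
    (hi : ¬ Complete n k h) (hw : SameWindow k h h') (H₁ : Valid G k D lev (c :: h))
    (hc : Complete n k (c :: h)) : Complete n k (c :: h') := by
  have hmem : ∀ v : Fin n, v.val + 1 ∈ c :: h' := fun v => by
    rcases List.mem_cons.1 (H₁.mem_of_complete hc v) with h1 | h1
    · simp [h1]
    · exact List.mem_cons_of_mem _ (H.mem_of_sameWindow hG H'.1 hi hw h1 (by omega))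
  have hz : ∀ i < k + 1, (c :: h').getD i 0 = 0 := fun i hi => by
    rw [← (hw.cons c).2 i (by omega)]
    exact ((le_gap_iff _ _).1 hc.2).2 i hi
  refine H'.complete_of_forall_mem hmem ?_ hz
  have v₀ : Fin n := hG.nonempty.some
  obtain ⟨i, hi⟩ := (mem_iff_getD (Nat.succ_ne_zero _)).1 (hmem v₀)
  by_contra hlt
  rcases Nat.lt_or_ge i (k + 1) with h1 | h1
  · rw [hz i h1] at hi; omega
  · rw [List.getD_eq_default _ _ (by omega)] at hi; omega

/-- The extension of `h` by `c` has been considered, with the nodes `H 0, …, H (tot - 1)`. -/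
def Handled (G : SimpleGraph (Fin n)) (k D : ℕ) (lev : ℕ → ℕ) (T : ℕ) (H : ℕ → List ℕ)
    (tot ans : ℕ) (h : List ℕ) (c : ℕ) : Prop :=
  Extends G k D lev h c →
    (Complete n k (c :: h) → h.length + 1 < T → ans = 1) ∧
    (¬ Complete n k (c :: h) → ∃ q < tot, SameWindow k (H q) (c :: h) ∧
      (H q).length ≤ h.length + 1)

/-- The invariant of the search: all extensions of the nodes before `head` and the extensions of
the node `head` by contents less than `c` have been considered. -/
structure Search (G : SimpleGraph (Fin n)) (k r D : ℕ) (lev : ℕ → ℕ) (H : ℕ → List ℕ)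
    (tot head c ans : ℕ) : Prop where
  pos : 0 < tot
  head_le : head ≤ tot
  root : H 0 = []
  valid : ∀ q < tot, Valid G k D lev (H q)
  incomplete : ∀ q < tot, ¬ Complete n k (H q)
  distinct : ∀ q < tot, ∀ q' < tot, SameWindow k (H q) (H q') → q = q'
  mono : ∀ i j, i ≤ j → j < tot → (H i).length ≤ (H j).length
  length_le : head < tot → ∀ j < tot, (H j).length ≤ (H head).length + 1
  handled : ∀ q < head, ∀ c ≤ n, Handled G k D lev ((r + 1) * (k + 1)) H tot ans (H q) c
  handled_head : ∀ d < c, Handled G k D lev ((r + 1) * (k + 1)) H tot ans (H head) d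
  sound : ans = 0 ∨ ans = 1 ∧ IsGridGraph G k r

namespace Search

variable {H : ℕ → List ℕ} {tot head c ans : ℕ}

theorem initial {H : ℕ → List ℕ} (hH : H 0 = []) : Search G k r D lev H 1 0 0 0 where
  pos := by omega
  head_le := by omega
  root := hH
  valid q hq := by
    obtain rfl : q = 0 := by omega
    rw [hH]; trivial
  incomplete q hq := by
    obtain rfl : q = 0 := by omega
    rw [hH]; simp [Complete, gap]
  distinct q hq q' hq' _ := by omega
  mono i j hij hj := by
    obtain rfl : i = j := by omega
    exact le_rfl
  length_le _ j hj := by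
    obtain rfl : j = 0 := by omega
    omega
  handled q hq := by omega
  handled_head d hd := by omega
  sound := Or.inl rfl

theorem of_handled (S : Search G k r D lev H tot head c ans)
    (hc : Handled G k D lev ((r + 1) * (k + 1)) H tot ans (H head) c) :
    Search G k r D lev H tot head (c + 1) ans :=
  { S with
    handled_head := fun d hd => by
      rcases Nat.lt_succ_iff_lt_or_eq.1 hd with h1 | rfl
      · exact S.handled_head d h1
      · exact hc }

theorem skip (S : Search G k r D lev H tot head c ans) (hc : ¬ Extends G k D lev (H head) c) :
    Search G k r D lev H tot head (c + 1) ans :=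
  S.of_handled fun h => absurd h hc

/-- By `length_le` no node is longer than the child. Replacing the child by a node with the same
window therefore loses nothing with regard to the bound on the length. -/
theorem duplicate (S : Search G k r D lev H tot head c ans) (hh : head < tot)
    (hi : ¬ Complete n k (c :: H head)) {z : ℕ} (hz : z < tot)
    (hw : SameWindow k (H z) (c :: H head)) : Search G k r D lev H tot head (c + 1) ans :=
  S.of_handled fun _ => ⟨fun h => absurd h hi, fun _ => ⟨z, hz, hw, S.length_le hh z hz⟩⟩

theorem reject (S : Search G k r D lev H tot head c ans) (hc : Complete n k (c :: H head))
    (hl : ¬ (H head).length + 1 < (r + 1) * (k + 1)) :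
    Search G k r D lev H tot head (c + 1) ans :=
  S.of_handled fun _ => ⟨fun _ h => absurd h hl, fun h => absurd hc h⟩

theorem accept (S : Search G k r D lev H tot head c ans) (hh : head < tot)
    (he : Extends G k D lev (H head) c) (hc : Complete n k (c :: H head))
    (hl : (H head).length + 1 < (r + 1) * (k + 1)) :
    Search G k r D lev H tot head (c + 1) 1 where
  __ := S
  handled q hq d hd he := ⟨fun _ _ => rfl, (S.handled q hq d hd he).2⟩
  handled_head d hd he := by
    refine ⟨fun _ _ => rfl, ?_⟩
    rcases Nat.lt_succ_iff_lt_or_eq.1 hd with h1 | rfl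
    · exact (S.handled_head d h1 he).2
    · exact fun h => absurd hc h
  sound := Or.inr ⟨rfl, Valid.isGridGraph (h := c :: H head) ⟨S.valid head hh, he⟩ hc
    (by simpa using hl)⟩

theorem push (S : Search G k r D lev H tot head c ans) (hh : head < tot)
    (he : Extends G k D lev (H head) c) (hi : ¬ Complete n k (c :: H head))
    (hd : ∀ z < tot, ¬ SameWindow k (H z) (c :: H head)) :
    Search G k r D lev (Function.update H tot (c :: H head)) (tot + 1) head (c + 1) ans := by
  have e : ∀ q < tot, Function.update H tot (c :: H head) q = H q := fun q hq =>
    Function.update_of_ne (by omega) _ _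
  have e' : Function.update H tot (c :: H head) tot = c :: H head := Function.update_self ..
  have cases : ∀ q < tot + 1, q < tot ∨ q = tot := fun q hq => by omega
  have keep : ∀ h d, Handled G k D lev ((r + 1) * (k + 1)) H tot ans h d →
      Handled G k D lev ((r + 1) * (k + 1)) (Function.update H tot (c :: H head)) (tot + 1)
        ans h d := by
    intro h d hd he
    refine ⟨(hd he).1, fun hi => ?_⟩
    obtain ⟨q, hq, h1⟩ := (hd he).2 hi
    exact ⟨q, by omega, by rwa [e q hq]⟩
  refine ⟨by omega, by omega, by rw [e 0 S.pos]; exact S.root, ?_, ?_, ?_, ?_, ?_, ?_, ?_, S.sound⟩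
  · intro q hq
    rcases cases q hq with h1 | rfl
    · rw [e q h1]; exact S.valid q h1
    · rw [e']; exact ⟨S.valid head hh, he⟩
  · intro q hq
    rcases cases q hq with h1 | rfl
    · rw [e q h1]; exact S.incomplete q h1
    · rwa [e']
  · intro q hq q' hq' hw
    rcases cases q hq with h1 | rfl <;> rcases cases q' hq' with h2 | rfl
    · rw [e q h1, e q' h2] at hw
      exact S.distinct q h1 q' h2 hw
    · rw [e q h1, e'] at hw
      exact absurd hw (hd q h1)
    · rw [e', e q' h2] at hw
      exact absurd hw.symm (hd q' h2)
    · rfl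
  · intro i j hij hj
    rcases cases j hj with h1 | rfl
    · rw [e i (by omega), e j h1]; exact S.mono i j hij h1
    · rcases cases i (by omega) with h2 | rfl
      · rw [e i h2, e']; exact S.length_le hh i h2
      · exact le_rfl
  · intro _ j hj
    rw [e head hh]
    rcases cases j hj with h1 | rfl
    · rw [e j h1]; exact S.length_le hh j h1
    · rw [e']; simp
  · intro q hq d hdn
    rw [e q (by omega)]
    exact keep _ _ (S.handled q hq d hdn)
  · intro d hdc
    rw [e head hh]
    rcases Nat.lt_succ_iff_lt_or_eq.1 hdc with h1 | rfl
    · exact keep _ _ (S.handled_head d h1)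
    · exact fun _ => ⟨fun h => absurd h hi, fun _ => ⟨tot, by omega, by
        rw [e']; exact ⟨⟨rfl, fun _ _ => rfl⟩, by simp⟩⟩⟩

theorem next (S : Search G k r D lev H tot head (n + 1) ans) (hh : head < tot) :
    Search G k r D lev H tot (head + 1) 0 ans where
  __ := S
  head_le := hh
  length_le h1 j hj := (S.length_le hh j hj).trans
    (Nat.add_le_add_right (S.mono head (head + 1) (by omega) h1) 1)
  handled q hq d hd := by
    rcases Nat.lt_succ_iff_lt_or_eq.1 hq with h1 | rfl
    · exact S.handled q h1 d hd
    · exact S.handled_head d (by omega)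
  handled_head d hd := by omega

/-- When the search ends, every window has been reached in the fewest possible steps. -/
theorem exists_node (hG : G.Connected) (S : Search G k r D lev H tot tot c ans)
    (Hh : Valid G k D lev h) (hi : ¬ Complete n k h) :
    ∃ q < tot, SameWindow k (H q) h ∧ (H q).length ≤ h.length := by
  induction h with
  | nil => exact ⟨0, S.pos, by rw [S.root]; exact ⟨rfl, fun _ _ => rfl⟩, by rw [S.root]⟩
  | cons c h ih =>
    have hi' : ¬ Complete n k h := fun h1 => hi (Hh.complete_cons h1)
    obtain ⟨q, hq, hw, hl⟩ := ih Hh.1 hi'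
    have he : Extends G k D lev (H q) c :=
      Hh.1.extends_of_sameWindow hG (S.valid q hq) hi' (S.incomplete q hq) hw.symm Hh.2
    obtain ⟨q', hq', hw', hl'⟩ := (S.handled q hq c Hh.2.le he).2 fun h1 =>
      hi ((S.valid q hq).complete_cons_of_sameWindow hG Hh (S.incomplete q hq) hw
        ⟨S.valid q hq, he⟩ h1)
    exact ⟨q', hq', hw'.trans (hw.cons c), by rw [List.length_cons]; omega⟩

/-- The search is exhaustive. -/
theorem ans_eq_one (hG : G.Connected) (S : Search G k r D lev H tot tot c ans)
    (Hh : Valid G k D lev h) (hc : Complete n k h) (hl : h.length < (r + 1) * (k + 1)) :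
    ans = 1 := by
  induction h with
  | nil => simp [Complete, gap] at hc
  | cons c h ih =>
    rw [List.length_cons] at hl
    -- The induction goes back to the cell at which the history becomes complete, since the window
    -- argument speaks of incomplete histories only.
    by_cases hc' : Complete n k h
    · exact ih Hh.1 hc' (by omega)
    obtain ⟨q, hq, hw, hl'⟩ := S.exists_node hG Hh.1 hc'
    have he : Extends G k D lev (H q) c :=
      Hh.1.extends_of_sameWindow hG (S.valid q hq) hc' (S.incomplete q hq) hw.symm Hh.2
    exact (S.handled q hq c Hh.2.le he).1 (Hh.1.complete_cons_of_sameWindow hG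
      ⟨S.valid q hq, he⟩ hc' hw.symm Hh hc) (by omega)

/-- The number of nodes is bounded by the number of possible windows. -/
theorem tot_le (S : Search G k r D lev H tot head c ans) {β : ℕ}
    (hβ : ∀ x ∈ Finset.Icc 1 n, (near n lev ((2 * k + 2) * D) x).card ≤ β) :
    tot ≤ (k + 1) * ((n + 1) * (β + 1) ^ (2 * k + 2)) := by
  classical
  -- Here `x` is one vertex of the window, or `0` if the window has none. The other entries are
  -- empty or have a level close to that of `x`.
  set near' : ℕ → Finset ℕ := fun x => if x = 0 then {0} else insert 0 (near n lev ((2 * k + 2) * D) x)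
  set W : Finset (Fin (2 * k + 2) → ℕ) :=
    (Finset.range (n + 1)).biUnion fun x => Fintype.piFinset fun _ => near' x
  have hW : W.card ≤ (n + 1) * (β + 1) ^ (2 * k + 2) := by
    refine (Finset.card_biUnion_le_card_mul _ _ ((β + 1) ^ (2 * k + 2)) ?_).trans (by simp)
    intro x hx
    rw [Fintype.card_piFinset_const]
    refine Nat.pow_le_pow_left ?_ _
    simp only [near']
    split_ifs with h0
    · simp
    · refine (Finset.card_insert_le _ _).trans (Nat.add_le_add_right (hβ x ?_) 1)
      simp only [Finset.mem_range] at hx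
      simp only [Finset.mem_Icc]
      omega
  have key : (Finset.range tot).card ≤ (Finset.range (k + 1) ×ˢ W).card := by
    refine Finset.card_le_card_of_injOn
      (fun q => (row k (H q), fun i : Fin (2 * k + 2) => (H q).getD i 0)) ?_ ?_
    · intro q hq
      simp only [Finset.coe_range, Set.mem_Iio] at hq
      simp only [Finset.coe_product, Set.mem_prod, Finset.mem_coe, Finset.mem_range]
      refine ⟨by rw [row_eq]; exact Nat.mod_lt _ (Nat.succ_pos k), ?_⟩
      simp only [W, Finset.mem_biUnion, Fintype.mem_piFinset, Finset.mem_range]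
      have V := S.valid q hq
      by_cases hz : ∀ i < 2 * k + 2, (H q).getD i 0 = 0
      · exact ⟨0, by omega, fun i => by simpa [near'] using hz i i.2⟩
      · push Not at hz
        obtain ⟨j, hj, h0⟩ := hz
        refine ⟨(H q).getD j 0, by have := V.getD_le j; omega, fun i => ?_⟩
        simp only [near', if_neg h0, Finset.mem_insert]
        by_cases hi0 : (H q).getD i 0 = 0
        · exact Or.inl hi0
        right
        have hle := V.getD_le i
        simp only [near, Finset.mem_filter, Finset.mem_Icc]
        refine ⟨by omega, ?_⟩
        rcases le_total (i : ℕ) j with hij | hij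
        · have h1 := V.lev_le i j hij hi0 h0
          have h2 : (j - i) * D ≤ (2 * k + 2) * D := Nat.mul_le_mul_right _ (by omega)
          omega
        · have h1 := V.lev_le j i hij h0 hi0
          have h2 : (i - j) * D ≤ (2 * k + 2) * D := Nat.mul_le_mul_right _ (by omega)
          omega
    · intro q hq q' hq' hqq
      simp only [Finset.coe_range, Set.mem_Iio] at hq hq'
      simp only [Prod.mk.injEq] at hqq
      exact S.distinct q hq q' hq' ⟨hqq.1, fun i hi => congrFun hqq.2 ⟨i, hi⟩⟩
  rw [Finset.card_range, Finset.card_product, Finset.card_range] at key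
  exact key.trans (Nat.mul_le_mul_left _ hW)

/-- Few nodes contain no vertex. -/
theorem card_empty_le (S : Search G k r D lev H tot head c ans) :
    ((Finset.range tot).filter fun q => newest (H q) = 0).card ≤ k + 1 := by
  have : ((Finset.range tot).filter fun q => newest (H q) = 0).card ≤ (Finset.range (k + 1)).card := by
    refine Finset.card_le_card_of_injOn (fun q => row k (H q)) ?_ ?_
    · intro q _
      simp only [Finset.coe_range, Set.mem_Iio]
      rw [row_eq]
      exact Nat.mod_lt _ (Nat.succ_pos k)
    -- Without a vertex all entries are `0`, so the next row alone determines the window.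
    · intro q hq q' hq' hqq
      simp only [Finset.coe_filter, Finset.mem_range, Set.mem_ofPred_eq] at hq hq'
      refine S.distinct q hq.1 q' hq'.1 ⟨hqq, fun i _ => ?_⟩
      rw [newest_eq_zero.1 hq.2, newest_eq_zero.1 hq'.2]
  simpa using this

end Search

open Classical in
/-- Few contents are candidates for the next cell. -/
theorem Valid.card_passes_le (H : Valid G k D lev h) {β : ℕ}
    (hβ : ∀ x ∈ Finset.Icc 1 n, (near n lev ((2 * k + 2) * D) x).card ≤ β) (h0 : newest h ≠ 0) :
    ((Finset.range (n + 1)).filter fun c => Passes k D lev h c).card ≤ β + 1 := by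
  have hn : newest h ∈ Finset.Icc 1 n := by
    obtain ⟨i, -, h1, -⟩ := newest_spec h0
    have := H.getD_le i
    simp only [Finset.mem_Icc]
    omega
  have hsub : ((Finset.range (n + 1)).filter fun c => Passes k D lev h c) ⊆
      insert 0 (near n lev D (newest h)) := by
    intro c hc
    simp only [Finset.mem_filter, Finset.mem_range] at hc
    simp only [near, Finset.mem_insert, Finset.mem_filter, Finset.mem_Icc]
    by_cases hc0 : c = 0
    · exact Or.inl hc0
    rcases hc.2 with h1 | ⟨-, h1 | h1⟩
    · exact Or.inl h1
    · exact absurd h1 h0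
    · exact Or.inr ⟨by omega, by omega⟩
  refine (Finset.card_le_card hsub).trans ((Finset.card_insert_le _ _).trans ?_)
  refine Nat.add_le_add_right ((Finset.card_le_card (near_mono ?_ _)).trans (hβ _ hn)) 1
  nlinarith [Nat.zero_le (k * D)]

end History

/-! ### The program -/

namespace GridSearch

open RAM History

/-! Variables: the input, constants computed from it, the state of the search, the node that is
being created, and scratch. -/

notation "vN" => (0 : ℕ)
notation "vK" => (1 : ℕ)
notation "vR" => (2 : ℕ)
notation "vCol" => (3 : ℕ)
notation "vWin" => (4 : ℕ)
notation "vEnd" => (5 : ℕ)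
notation "vD" => (6 : ℕ)
notation "vAns" => (7 : ℕ)
notation "vTot" => (8 : ℕ)
notation "vHead" => (9 : ℕ)
notation "vC" => (10 : ℕ)
notation "vOk" => (11 : ℕ)
notation "vLen" => (12 : ℕ)
notation "vPlaced" => (13 : ℕ)
notation "vGap" => (14 : ℕ)
notation "vNew" => (15 : ℕ)
notation "vRow" => (16 : ℕ)
notation "vX" => (17 : ℕ)
notation "vI" => (18 : ℕ)
notation "vZ" => (19 : ℕ)
notation "vSame" => (20 : ℕ)

/-! Arrays: the adjacency matrix, the offsets of its rows, the levels, the queue for computing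
them, the attributes of the nodes, and the window of the current node. -/

notation "aAdj" => (0 : ℕ)
notation "aOff" => (1 : ℕ)
notation "aLev" => (2 : ℕ)
notation "aQue" => (3 : ℕ)
notation "aPar" => (4 : ℕ)
notation "aCon" => (5 : ℕ)
notation "aLen" => (6 : ℕ)
notation "aPlaced" => (7 : ℕ)
notation "aGap" => (8 : ℕ)
notation "aNew" => (9 : ℕ)
notation "aRow" => (10 : ℕ)
notation "aWin" => (11 : ℕ)

open Expr in
/-- Check that `vC` is not among the contents of the node `vHead`. -/
def freshCheck : Prog :=
  .seq (.assign vX (var vHead))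
    (.loop (var vX)
      (.seq (.cond (and (var vC) (eq (get aCon (var vX)) (var vC))) (.assign vOk (const 0)) .skip)
        (.assign vX (get aPar (var vX)))))

open Expr in
-- Cell `0` of `aWin` holds the candidate and the cells `1, …, 2k + 2` hold the window of `vHead`.
-- Thus cell `vCol` is one column before the candidate, and the cells `0`, `vK`, `vCol + 1`, `vWin`
-- are the ones next to it.
def closeCheck : Prog :=
  .cond (get aWin (var vCol))
    (.for vI (var vN)
      (.cond
        (and (get aAdj (add (get aOff (get aWin (var vCol))) (var vI)))
          (and (and (ne (add (var vI) (const 1)) (get aWin (const 0)))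
              (ne (add (var vI) (const 1)) (get aWin (var vK))))
            (and (ne (add (var vI) (const 1)) (get aWin (add (var vCol) (const 1))))
              (ne (add (var vI) (const 1)) (get aWin (var vWin))))))
        (.assign vOk (const 0)) .skip))
    .skip

open Expr in
/-- Compare the window with that of the node `vZ`. -/
def compare : Prog :=
  .seq (.assign vSame (eq (get aRow (var vZ)) (var vRow)))
    (.seq (.assign vX (var vZ))
      (.for vI (var vWin)
        (.seq (.cond (ne (get aCon (var vX)) (get aWin (var vI))) (.assign vSame (const 0)) .skip)
          (.assign vX (get aPar (var vX))))))

open Expr in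
-- The linear scan of all nodes is the source of the second factor `n` in the running time.
def duplicateCheck : Prog :=
  .for vZ (var vTot) (.seq compare (.cond (var vSame) (.assign vOk (const 0)) .skip))

open Expr in
/-- Compute the attributes of the child of `vHead` with content `vC`. -/
def attributes : Prog :=
  .seq (.assign vLen (add (get aLen (var vHead)) (const 1)))
    (.seq
      (.cond (eq (get aRow (var vHead)) (var vK)) (.assign vRow (const 0))
        (.assign vRow (add (get aRow (var vHead)) (const 1))))
      (.cond (var vC)
        (.seq (.assign vPlaced (add (get aPlaced (var vHead)) (const 1)))
          (.seq (.assign vGap (const 0)) (.assign vNew (var vC))))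
        (.seq (.assign vPlaced (get aPlaced (var vHead)))
          (.seq (.assign vGap (add (get aGap (var vHead)) (const 1)))
            (.assign vNew (get aNew (var vHead)))))))

open Expr in
def push : Prog :=
  .seq (.put aPar (var vTot) (var vHead))
    (.seq (.put aCon (var vTot) (var vC))
      (.seq (.put aLen (var vTot) (var vLen))
        (.seq (.put aPlaced (var vTot) (var vPlaced))
          (.seq (.put aGap (var vTot) (var vGap))
            (.seq (.put aNew (var vTot) (var vNew))
              (.seq (.put aRow (var vTot) (var vRow))
                (.assign vTot (add (var vTot) (const 1)))))))))

open Expr in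
/-- Consider the child of `vHead` with content `vC`. -/
def expand : Prog :=
  .seq (.put aWin (const 0) (var vC))
    (.seq (.assign vOk (const 1))
      (.seq freshCheck
        (.seq closeCheck
          (.cond (var vOk)
            (.seq attributes
              (.cond (and (le (var vN) (var vPlaced)) (le (var vCol) (var vGap)))
                (.cond (lt (var vLen) (var vEnd)) (.assign vAns (const 1)) .skip)
                (.seq duplicateCheck (.cond (var vOk) push .skip))))
            .skip))))

open Expr in
/-- The test whether `vC` is a candidate for a child of `vHead`. -/
def passes : Expr :=
  add (eq (var vC) (const 0))
    (and (ne (get aRow (var vHead)) (var vK))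
      (add (eq (get aNew (var vHead)) (const 0))
        (and (le (get aLev (var vC)) (add (get aLev (get aNew (var vHead))) (var vD)))
          (le (get aLev (get aNew (var vHead))) (add (get aLev (var vC)) (var vD))))))

open Expr in
-- The root is its own parent and has content `0`, so a history shorter than the window is padded
-- with empty cells.
def loadWindow : Prog :=
  .seq (.assign vX (var vHead))
    (.for vI (var vWin)
      (.seq (.put aWin (add (var vI) (const 1)) (get aCon (var vX)))
        (.assign vX (get aPar (var vX)))))

open Expr in
def visit : Prog :=
  .seq loadWindow
    (.seq (.for vC (add (var vN) (const 1)) (.cond passes expand .skip))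
      (.assign vHead (add (var vHead) (const 1))))

open Expr in
def search : Prog :=
  .seq (.assign vTot (const 1))
    (.seq (.assign vHead (const 0)) (.loop (lt (var vHead) (var vTot)) visit))

open Expr in
-- At `D = n` the condition on levels is void, since levels lie between `1` and `n`.
def searches : Prog :=
  .seq (.assign vD (const 0))
    (.seq (.assign vAns (const 0))
      (.loop (and (not (var vAns)) (lt (var vD) (var vN)))
        (.seq (.assign vD (add (var vD) (const 1))) search)))

open Expr in
-- The product `(r + 1) * (k + 1)` is formed by `k + 1` additions, so that the time does not depend
-- on `r`. The row offsets are multiples of `n`, indexed by contents, that is, vertices plus one.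
def constants : Prog :=
  .seq (.assign vCol (add (var vK) (const 1)))
    (.seq (.assign vWin (add (var vCol) (var vCol)))
      (.seq (.assign vEnd (const 0))
        (.seq (.for vI (var vCol) (.assign vEnd (add (var vEnd) (add (var vR) (const 1)))))
          (.seq (.assign vX (const 0))
            (.for vI (var vN)
              (.seq (.put aOff (add (var vI) (const 1)) (var vX))
                (.assign vX (add (var vX) (var vN)))))))))

open Expr in
/-- Breadth first search from the first vertex. -/
def levels : Prog :=
  .seq (.put aLev (const 1) (const 1))
    (.seq (.put aQue (const 0) (const 1))
      (.seq (.assign vTot (const 1))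
        (.seq (.assign vHead (const 0))
          (.loop (lt (var vHead) (var vTot))
            (.seq
              (.seq (.assign vX (get aQue (var vHead)))
                (.for vI (var vN)
                  (.cond
                    (and (get aAdj (add (get aOff (var vX)) (var vI)))
                      (not (get aLev (add (var vI) (const 1)))))
                    (.seq (.put aLev (add (var vI) (const 1)) (add (get aLev (var vX)) (const 1)))
                      (.seq (.put aQue (var vTot) (add (var vI) (const 1)))
                        (.assign vTot (add (var vTot) (const 1)))))
                    .skip)))
              (.assign vHead (add (var vHead) (const 1))))))))

open Expr in
def program : Prog :=
  .seq constants (.seq levels (.seq searches (.assign vN (var vAns))))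

/-! ### Memory invariants and the checks made for a child -/

variable {n : ℕ} {G : SimpleGraph (Fin n)} {k r D : ℕ} {lev : ℕ → ℕ} {s s' : State}

/-- The memory holds the adjacency matrix. -/
structure Table (G : SimpleGraph (Fin n)) (s : State) : Prop where
  n_eq : s.var vN = n
  adj : ∀ c, 1 ≤ c → c ≤ n → ∀ y < n, s.arr aAdj (s.arr aOff c + y) ≠ 0 ↔ ContentAdj G c (y + 1)

/-- The memory holds the constants of the search with parameter `D`. -/
structure Env (G : SimpleGraph (Fin n)) (k r D : ℕ) (lev : ℕ → ℕ) (s : State) : Prop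
    extends Table G s where
  k_eq : s.var vK = k
  col_eq : s.var vCol = k + 1
  win_eq : s.var vWin = 2 * k + 2
  end_eq : s.var vEnd = (r + 1) * (k + 1)
  d_eq : s.var vD = D
  lev_eq : s.arr aLev = lev

/-- The memory holds the nodes `H 0, …, H (tot - 1)`. -/
structure Nodes (k : ℕ) (H : ℕ → List ℕ) (tot : ℕ) (s : State) : Prop where
  par : ∀ q < tot, s.arr aPar q < tot ∧ H (s.arr aPar q) = (H q).tail
  -- Truncated subtraction makes the root its own parent; every other node has a smaller parent.
  par_le : ∀ q < tot, s.arr aPar q ≤ q - 1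
  con : ∀ q < tot, s.arr aCon q = (H q).getD 0 0
  len : ∀ q < tot, s.arr aLen q = (H q).length
  placed : ∀ q < tot, s.arr aPlaced q = History.placed (H q)
  gap : ∀ q < tot, s.arr aGap q = History.gap (H q)
  new : ∀ q < tot, s.arr aNew q = newest (H q)
  row : ∀ q < tot, s.arr aRow q = History.row k (H q)

theorem Table.agree {vs as : List ℕ} (h : Table G s) (a : Agree vs as s s')
    (hv : ∀ x ∈ [vN], x ∉ vs) (ha : ∀ x ∈ [aAdj, aOff], x ∉ as) : Table G s' := by
  simp only [List.mem_cons, List.not_mem_nil, or_false, forall_eq_or_imp, forall_eq] at hv ha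
  constructor
  · rw [a.var _ hv, h.n_eq]
  · rw [a.arr _ ha.1, a.arr _ ha.2]; exact h.adj

theorem Env.agree {vs as : List ℕ} (h : Env G k r D lev s) (a : Agree vs as s s')
    (hv : ∀ x ∈ [vN, vK, vCol, vWin, vEnd, vD], x ∉ vs)
    (ha : ∀ x ∈ [aAdj, aOff, aLev], x ∉ as) : Env G k r D lev s' := by
  have ht : Table G s' := h.toTable.agree a (fun x hx => hv x (by simp at hx ⊢; omega))
    (fun x hx => ha x (by simp at hx ⊢; omega))
  simp only [List.mem_cons, List.not_mem_nil, or_false, forall_eq_or_imp, forall_eq] at hv ha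
  obtain ⟨-, h1, h2, h3, h4, h5⟩ := hv
  obtain ⟨-, -, h8⟩ := ha
  exact { ht with
    k_eq := by rw [a.var _ h1, h.k_eq]
    col_eq := by rw [a.var _ h2, h.col_eq]
    win_eq := by rw [a.var _ h3, h.win_eq]
    end_eq := by rw [a.var _ h4, h.end_eq]
    d_eq := by rw [a.var _ h5, h.d_eq]
    lev_eq := by rw [a.arr _ h8, h.lev_eq] }

theorem Nodes.agree {vs as : List ℕ} {H : ℕ → List ℕ} {tot : ℕ} (h : Nodes k H tot s)
    (a : Agree vs as s s')
    (ha : ∀ x ∈ [aPar, aCon, aLen, aPlaced, aGap, aNew, aRow], x ∉ as) : Nodes k H tot s' := by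
  simp only [List.mem_cons, List.not_mem_nil, or_false, forall_eq_or_imp, forall_eq] at ha
  obtain ⟨h1, h2, h3, h4, h5, h6, h7⟩ := ha
  obtain ⟨g1, g1', g2, g3, g4, g5, g6, g7⟩ := h
  constructor
  · rwa [a.arr _ h1]
  · rwa [a.arr _ h1]
  · rwa [a.arr _ h2]
  · rwa [a.arr _ h3]
  · rwa [a.arr _ h4]
  · rwa [a.arr _ h5]
  · rwa [a.arr _ h6]
  · rwa [a.arr _ h7]

variable {H : ℕ → List ℕ} {tot head : ℕ} {g : List ℕ}

/-- Parents have smaller numbers, so the number of the current node bounds the rounds that remain.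
The loop stops at the root, whose history is empty. -/
theorem freshCheck_runs (hN : Nodes k H tot s) (h0 : H 0 = []) (hh : s.var vHead < tot) :
    Runs freshCheck s (30 * tot + 5) fun s' => Agree [vX, vOk] [] s s' ∧
      (s'.var vOk ≠ 0 ↔ s.var vOk ≠ 0 ∧ (s.var vC = 0 ∨ s.var vC ∉ H (s.var vHead))) := by
  apply runs_of_wp
  apply Wp.seq
  apply Wp.assign
  have key : Runs (.loop (.var vX) (.seq (.cond (.and (.var vC) (.eq (.get aCon (.var vX)) (.var vC)))
      (.assign vOk (.const 0)) .skip) (.assign vX (.get aPar (.var vX)))))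
      (s.assign vX (s.var vHead)) (30 * s.var vHead + 2) fun s' => Agree [vX, vOk] [] s s' ∧
      (s'.var vOk ≠ 0 ↔ s.var vOk ≠ 0 ∧ (s.var vC = 0 ∨ s.var vC ∉ H (s.var vHead))) := by
    refine Runs.loop (fun T s' => Agree [vX, vOk] [] s s' ∧ s'.var vX < tot ∧
      T = 30 * s'.var vX + 2 ∧ ((s.var vOk ≠ 0 ∧ (s.var vC = 0 ∨ s.var vC ∉ H (s.var vHead))) ↔
        s'.var vOk ≠ 0 ∧ (s.var vC = 0 ∨ s.var vC ∉ H (s'.var vX)))) ?_ ?_ ?_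
    · exact ⟨(Agree.refl _ _ _).assign (by simp), by simpa using hh, by simp, by simp⟩
    · rintro T s₁ ⟨hA, hx, rfl, hI⟩ hb
      simp only [Expr.eval] at hb
      have hp := hN.par _ hx
      have hlt := hN.par_le _ hx
      have hc := hN.con _ hx
      have ea := hA.arr aPar (by simp)
      have ec := hA.arr aCon (by simp)
      have eC := hA.var vC (by simp)
      have hmem : s.var vC ≠ 0 → (s.var vC ∈ H (s₁.var vX) ↔
          s.arr aCon (s₁.var vX) = s.var vC ∨ s.var vC ∈ H (s.arr aPar (s₁.var vX))) := by
        intro h1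
        rw [hp.2, hc]
        cases H (s₁.var vX) with
        | nil => simpa using h1.symm
        | cons a l => simp [eq_comm]
      apply Wp.seq
      apply Wp.cond
      · intro hb
        apply Wp.assign
        apply Wp.assign
        simp only [Expr.eval_and, Expr.eval_eq, Expr.eval, ec, eC, not_or, not_not, ne_eq] at hb
        refine ⟨30 * s.arr aPar (s₁.var vX) + 2, ?_, (hA.assign (by simp)).assign (by simp),
          by simpa [Expr.eval, ea] using hp.1, by simp [Expr.eval, ea], ?_⟩
        · simp [Expr.cost]; omega
        · rw [hI]
          simp [Expr.eval, hb.1, (hmem hb.1).2 (Or.inl hb.2)]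
      · intro hb
        apply Wp.skip
        apply Wp.assign
        simp only [Expr.eval_and, Expr.eval_eq, Expr.eval, ec, eC, ne_eq] at hb
        refine ⟨30 * s.arr aPar (s₁.var vX) + 2, ?_, hA.assign (by simp),
          by simpa [Expr.eval, ea] using hp.1, by simp [Expr.eval, ea], ?_⟩
        · simp [Expr.cost]; omega
        · rw [hI]
          by_cases h1 : s.var vC = 0
          · simp [h1]
          · have := hb.resolve_left h1
            simp [Expr.eval, ea, h1, hmem h1, this]
    · rintro T s₁ ⟨hA, hx, rfl, hI⟩ hb
      simp only [Expr.eval] at hb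
      refine ⟨by simp [Expr.cost], hA, ?_⟩
      rw [hI, hb, h0]
      simp
  refine key.wp fun s' t' h h' => ⟨?_, h⟩
  simp [Expr.cost] at h' ⊢
  omega

theorem closeCheck_runs (hE : Env G k r D lev s) (hw : ∀ j < 2 * k + 3, s.arr aWin j = g.getD j 0)
    (hg : g.getD (k + 1) 0 ≤ n) :
    Runs closeCheck s (110 * n + 100) fun s' => Agree [vI, vOk] [] s s' ∧
      (s'.var vOk ≠ 0 ↔ s.var vOk ≠ 0 ∧ Closes G k g) := by
  have w1 := hw (k + 1) (by omega)
  apply runs_of_wp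
  apply Wp.cond
  · intro hb
    simp [-List.getD_eq_getElem?_getD, Expr.eval, hE.col_eq, w1] at hb
    refine (Runs.for (m := n) (fun j s' => Agree [vI, vOk] [] s s' ∧ s'.var vI = j ∧
      (s'.var vOk ≠ 0 ↔ s.var vOk ≠ 0 ∧ ∀ y < j, ContentAdj G (g.getD (k + 1) 0) (y + 1) →
        y + 1 = g.getD 0 0 ∨ y + 1 = g.getD k 0 ∨ y + 1 = g.getD (k + 2) 0 ∨
          y + 1 = g.getD (2 * k + 2) 0)) (fun _ => 100) (P := fun s' => Agree [vI, vOk] [] s s' ∧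
      (s'.var vOk ≠ 0 ↔ s.var vOk ≠ 0 ∧ Closes G k g)) ?_ ?_ ?_ ?_).wp ?_
    · exact ⟨(Agree.refl _ _ _).assign (by simp), by simp, by simp⟩
    · rintro j s₁ ⟨hA, hj, -⟩
      exact ⟨hj, by simp [Expr.eval, hA.var vN, hE.n_eq]⟩
    · rintro j s₁ ⟨hA, hj, hI⟩ hjn
      have hadj := hE.adj _ (Nat.pos_of_ne_zero hb) hg j hjn
      have hK := hE.k_eq
      have hC := hE.col_eq
      have hW := hE.win_eq
      have w0 := hw 0 (by omega)
      have w2 := hw k (by omega)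
      have w3 := hw (k + 2) (by omega)
      have w4 := hw (2 * k + 2) (by omega)
      apply Wp.cond
      · intro hb
        simp [-List.getD_eq_getElem?_getD, Expr.eval, hA.var, hA.arr, hj, hK, hC, hW, w0, w1, w2, w3,
          w4] at hb
        apply Wp.assign
        refine ⟨by simp [Expr.cost], (hA.assign (by simp)).assign (by simp), by simp [hj], ?_⟩
        rw [Nat.forall_lt_succ_right]
        simp [-List.getD_eq_getElem?_getD, Expr.eval]
        intro _ _
        exact ⟨hadj.1 hb.1, hb.2.1.1, hb.2.1.2, hb.2.2.1, hb.2.2.2⟩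
      · intro hb
        simp [-List.getD_eq_getElem?_getD, Expr.eval, hA.var, hA.arr, hj, hK, hC, hW, w0, w1, w2, w3,
          w4] at hb
        apply Wp.skip
        refine ⟨by simp [Expr.cost], hA.assign (by simp), by simp [hj], ?_⟩
        rw [Nat.forall_lt_succ_right]
        have : ContentAdj G (g.getD (k + 1) 0) (j + 1) → j + 1 = g.getD 0 0 ∨ j + 1 = g.getD k 0 ∨
            j + 1 = g.getD (k + 2) 0 ∨ j + 1 = g.getD (2 * k + 2) 0 := by
          intro h1
          rcases hb with h | (h | h) | h | h
          · exact absurd h (hadj.2 h1)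
          · exact Or.inl h
          · exact Or.inr (Or.inl h)
          · exact Or.inr (Or.inr (Or.inl h))
          · exact Or.inr (Or.inr (Or.inr h))
        exact ⟨fun h => ⟨(hI.1 h).1, (hI.1 h).2, this⟩, fun h => hI.2 ⟨h.1, h.2.1⟩⟩
    · rintro s₁ ⟨hA, hj, hI⟩
      refine ⟨hA, hI.trans (and_congr_right fun _ => ⟨fun h y hy => ?_, fun h y _ => h (y + 1)⟩)⟩
      obtain ⟨u, v, huv, hu, rfl⟩ := id hy
      exact h v v.2 hy
    · intro s₁ t h ht
      refine ⟨?_, h⟩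
      simp [Expr.cost] at ht
      omega
  · intro hb
    simp [-List.getD_eq_getElem?_getD, Expr.eval, hE.col_eq, w1] at hb
    apply Wp.skip
    refine ⟨by simp [Expr.cost], Agree.refl _ _ _, ?_⟩
    refine (and_iff_left ?_).symm
    rintro y ⟨u, v, -, hu, -⟩
    omega

/-- After `j` parents the history has lost its newest `j` entries; past the root it stays empty, in
agreement with the default value `0` of `getD`. -/
theorem compare_runs (hN : Nodes k H tot s) (hW : s.var vWin = 2 * k + 2)
    (hr : s.var vRow = row k g) (hw : ∀ j < 2 * k + 2, s.arr aWin j = g.getD j 0)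
    (hz : s.var vZ < tot) :
    Runs compare s (40 * (2 * k + 2) + 40) fun s' => Agree [vX, vI, vSame] [] s s' ∧
      (s'.var vSame ≠ 0 ↔ SameWindow k (H (s.var vZ)) g) := by
  apply runs_of_wp
  apply Wp.seq
  apply Wp.assign
  apply Wp.seq
  apply Wp.assign
  refine (Runs.for (m := 2 * k + 2) (fun j s' => Agree [vX, vI, vSame] [] s s' ∧ s'.var vI = j ∧
      s'.var vX < tot ∧ H (s'.var vX) = (H (s.var vZ)).drop j ∧ (s'.var vSame ≠ 0 ↔
        row k (H (s.var vZ)) = row k g ∧ ∀ i < j, (H (s.var vZ)).getD i 0 = g.getD i 0))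
      (fun _ => 30) (P := fun s' => Agree [vX, vI, vSame] [] s s' ∧
      (s'.var vSame ≠ 0 ↔ SameWindow k (H (s.var vZ)) g)) ?_ ?_ ?_ ?_).wp ?_
  · refine ⟨(((Agree.refl _ _ _).assign (by simp)).assign (by simp)).assign (by simp), by simp,
      by simpa [Expr.eval] using hz, by simp [Expr.eval], ?_⟩
    rw [← hr, ← hN.row _ hz]
    simp
    rfl
  · rintro j s₁ ⟨hA, hj, -⟩
    exact ⟨hj, by simp [Expr.eval, hA.var, hW]⟩
  · rintro j s₁ ⟨hA, hj, hx, hH, hI⟩ hjn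
    have hp := hN.par _ hx
    have hc := hN.con _ hx
    rw [hH] at hc hp
    have hc' : s.arr aCon (s₁.var vX) = (H (s.var vZ)).getD j 0 := by
      rw [hc]; simp [List.getD_eq_getElem?_getD]
    have hwj := hw j hjn
    apply Wp.seq
    apply Wp.cond
    · intro hb
      simp [Expr.eval, hA.arr, hj, hc', hwj] at hb
      apply Wp.assign
      apply Wp.assign
      refine ⟨by simp [Expr.cost], ((hA.assign (by simp)).assign (by simp)).assign (by simp),
        by simp [hj], by simpa [Expr.eval, hA.arr] using hp.1, by simpa [Expr.eval, hA.arr] using hp.2, ?_⟩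
      rw [Nat.forall_lt_succ_right]
      simp [Expr.eval]
      intro _ _
      exact hb
    · intro hb
      simp [Expr.eval, hA.arr, hj, hc', hwj] at hb
      apply Wp.skip
      apply Wp.assign
      refine ⟨by simp [Expr.cost], (hA.assign (by simp)).assign (by simp),
        by simp [hj], by simpa [Expr.eval, hA.arr] using hp.1, by simpa [Expr.eval, hA.arr] using hp.2, ?_⟩
      rw [Nat.forall_lt_succ_right]
      simpa [hb] using hI
  · rintro s₁ ⟨hA, hj, -, -, hI⟩
    exact ⟨hA, hI⟩
  · intro s₁ t h ht
    refine ⟨?_, h⟩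
    simp [Expr.cost] at ht
    omega

theorem duplicateCheck_runs (hN : Nodes k H tot s) (hW : s.var vWin = 2 * k + 2)
    (hT : s.var vTot = tot)
    (hr : s.var vRow = row k g) (hw : ∀ j < 2 * k + 2, s.arr aWin j = g.getD j 0) :
    Runs duplicateCheck s (tot * (40 * (2 * k + 2) + 60) + 10) fun s' =>
      Agree [vZ, vX, vI, vSame, vOk] [] s s' ∧
      (s'.var vOk ≠ 0 ↔ s.var vOk ≠ 0 ∧ ∀ z < tot, ¬ SameWindow k (H z) g) := by
  refine (Runs.for (m := tot) (fun j s' => Agree [vZ, vX, vI, vSame, vOk] [] s s' ∧ s'.var vZ = j ∧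
      (s'.var vOk ≠ 0 ↔ s.var vOk ≠ 0 ∧ ∀ z < j, ¬ SameWindow k (H z) g))
      (fun _ => 40 * (2 * k + 2) + 50) (P := fun s' => Agree [vZ, vX, vI, vSame, vOk] [] s s' ∧
      (s'.var vOk ≠ 0 ↔ s.var vOk ≠ 0 ∧ ∀ z < tot, ¬ SameWindow k (H z) g)) ?_ ?_ ?_ ?_).mono ?_
      fun _ => id
  · exact ⟨(Agree.refl _ _ _).assign (by simp), by simp, by simp⟩
  · rintro j s₁ ⟨hA, hj, -⟩
    exact ⟨hj, by simp [Expr.eval, hA.var, hT]⟩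
  · rintro j s₁ ⟨hA, hj, hI⟩ hjn
    apply Wp.seq
    refine (compare_runs (s := s₁) (H := H) (tot := tot) (g := g) (hN.agree hA (by simp))
      (by simp [hA.var, hW]) (by simp [hA.var, hr])
      (by simpa [hA.arr] using hw) (by omega)).wp ?_
    rintro s₂ t ⟨hA', hS⟩ ht
    have hA₂ : Agree [vZ, vX, vI, vSame, vOk] [] s s₂ := hA.trans (hA'.mono (by simp) (by simp))
    rw [hj] at hS
    have hok := hA'.var vOk (by simp)
    have hz := hA'.var vZ (by simp)
    apply Wp.cond
    · intro hb
      simp only [Expr.eval] at hb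
      apply Wp.assign
      refine ⟨by simp [Expr.cost]; omega, (hA₂.assign (by simp)).assign (by simp),
        by simp [hz, hj], ?_⟩
      rw [Nat.forall_lt_succ_right]
      simp [Expr.eval, hS.1 hb]
    · intro hb
      simp only [Expr.eval] at hb
      apply Wp.skip
      refine ⟨by simp [Expr.cost]; omega, hA₂.assign (by simp), by simp [hz, hj], ?_⟩
      rw [Nat.forall_lt_succ_right]
      have : ¬ SameWindow k (H j) g := fun h => hS.2 h hb
      simpa [this, hok] using hI
  · rintro s₁ ⟨hA, -, hI⟩
    exact ⟨hA, hI⟩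
  · simp [Expr.cost]
    nlinarith

end GridSearch

/-! ### Considering one child -/

namespace GridSearch

open RAM History

variable {n : ℕ} {G : SimpleGraph (Fin n)} {k r D : ℕ} {lev : ℕ → ℕ} {s s' : State}
variable {H : ℕ → List ℕ} {tot head c : ℕ}

theorem attributes_runs (hE : Env G k r D lev s) (hN : Nodes k H tot s) (hh : s.var vHead < tot) :
    Runs attributes s 100 fun s' => Agree [vLen, vPlaced, vGap, vNew, vRow] [] s s' ∧
      s'.var vLen = (s.var vC :: H (s.var vHead)).length ∧
      s'.var vPlaced = placed (s.var vC :: H (s.var vHead)) ∧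
      s'.var vGap = gap (s.var vC :: H (s.var vHead)) ∧
      s'.var vNew = newest (s.var vC :: H (s.var vHead)) ∧
      s'.var vRow = row k (s.var vC :: H (s.var vHead)) := by
  have h1 := hN.len _ hh
  have h2 := hN.placed _ hh
  have h3 := hN.gap _ hh
  have h4 := hN.new _ hh
  have h5 := hN.row _ hh
  have hk := hE.k_eq
  apply runs_of_wp
  apply Wp.seq
  apply Wp.assign
  apply Wp.seq
  apply Wp.cond
  all_goals
    intro hb
    simp [Expr.eval, h5, hk] at hb
    apply Wp.assign
    apply Wp.cond
    all_goals
      intro hc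
      simp [Expr.eval] at hc
      apply Wp.seq
      apply Wp.assign
      apply Wp.seq
      apply Wp.assign
      apply Wp.assign
      refine ⟨by simp [Expr.cost], ?_, ?_⟩
      · exact (((((Agree.refl _ _ _).assign (by simp)).assign (by simp)).assign (by simp)).assign
          (by simp)).assign (by simp)
      · simp [Expr.eval, h1, h2, h3, h4, h5, placed, gap, newest, row, hb, hc]

theorem push_runs (hN : Nodes k H tot s) (hT : s.var vTot = tot) (hh : s.var vHead < tot)
    {g : List ℕ} (hg : g = s.var vC :: H (s.var vHead)) (h1 : s.var vLen = g.length)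
    (h2 : s.var vPlaced = placed g) (h3 : s.var vGap = gap g) (h4 : s.var vNew = newest g)
    (h5 : s.var vRow = row k g) :
    Runs push s 100 fun s' =>
      Agree [vTot] [aPar, aCon, aLen, aPlaced, aGap, aNew, aRow] s s' ∧ s'.var vTot = tot + 1 ∧
      Nodes k (Function.update H tot g) (tot + 1) s' := by
  apply runs_of_wp
  unfold push
  iterate 7
    apply Wp.seq
    apply Wp.put
  apply Wp.assign
  refine ⟨by simp [Expr.cost], ?_, by simp [Expr.eval, hT], ?_⟩
  · exact ((((((((Agree.refl _ _ _).put (by simp)).put (by simp)).put (by simp)).put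
      (by simp)).put (by simp)).put (by simp)).put (by simp)).assign (by simp)
  · constructor
    all_goals
      intro q hq
      simp only [State.arr_assign, State.arr_put, State.var_put, Expr.eval, Nat.reduceEqDiff, if_true,
        if_false, hT]
      rcases Nat.lt_succ_iff_lt_or_eq.1 hq with hlt | rfl
      · have hne : q ≠ tot := by omega
        rw [Function.update_of_ne hne]
        first
        | exact hN.par_le q hlt
        | rw [Function.update_of_ne hne]
          first
          | exact hN.con q hlt
          | exact hN.len q hlt
          | exact hN.placed q hlt
          | exact hN.gap q hlt
          | exact hN.new q hlt
          | exact hN.row q hlt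
          | have := hN.par q hlt
            rw [Function.update_of_ne (by omega)]
            exact ⟨by omega, this.2⟩
      · rw [Function.update_self]
        first
        | omega
        | rw [Function.update_self]
          first
          | assumption
          | rw [hg]; rfl
          | rw [Function.update_of_ne (by omega)]
            exact ⟨by omega, by rw [hg]; rfl⟩

/-- The state of the search is in memory. -/
structure Ready (G : SimpleGraph (Fin n)) (k r D : ℕ) (lev : ℕ → ℕ) (H : ℕ → List ℕ)
    (tot head c : ℕ) (s : State) : Prop where
  env : Env G k r D lev s
  nodes : Nodes k H tot s
  tot_eq : s.var vTot = tot
  head_eq : s.var vHead = head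
  search : Search G k r D lev H tot head c (s.var vAns)

theorem passes_eval (hR : Ready G k r D lev H tot head c s) (hh : head < tot)
    (hc : s.var vC = c) : passes.eval s = 0 ↔ ¬ Passes k D lev (H head) c := by
  have h4 := hR.nodes.new _ hh
  have h5 := hR.nodes.row _ hh
  simp only [passes, Passes, Expr.eval_or, Expr.eval_and, Expr.eval_eq, Expr.eval_ne, Expr.eval_le]
  simp only [Expr.eval, hR.head_eq, hc, h4, h5, hR.env.k_eq, hR.env.d_eq, hR.env.lev_eq]
  tauto

/-- The time for considering a child. -/
def expandTime (n k Q : ℕ) : ℕ := Q * (40 * (2 * k + 2) + 90) + 110 * n + 600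

/-- The old nodes and the loaded window survive, so that the remaining children of the same node can
be considered without loading it again. -/
theorem expand_runs (hR : Ready G k r D lev H tot head c s) (hh : head < tot)
    (hc : s.var vC = c) (hcn : c ≤ n) (hp : Passes k D lev (H head) c)
    (hw : ∀ j < 2 * k + 2, s.arr aWin (j + 1) = (H head).getD j 0) {Q : ℕ} (hQ : tot ≤ Q) :
    Runs expand s (expandTime n k Q) fun s' => ∃ H' tot', Ready G k r D lev H' tot' head (c + 1) s' ∧
      tot ≤ tot' ∧ (∀ q < tot, H' q = H q) ∧ s'.var vC = c ∧
      ∀ j < 2 * k + 2, s'.arr aWin (j + 1) = (H head).getD j 0 := by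
  obtain ⟨hE, hN, hT, hH, hS⟩ := hR
  have hV := hS.valid head hh
  -- Per node, `40 * (2 * k + 2) + 60` pays for the search for duplicates and `30` for the check of
  -- freshness.
  have hQm : tot * (40 * (2 * k + 2) + 60) + 30 * tot ≤ Q * (40 * (2 * k + 2) + 90) :=
    le_trans (by rw [mul_comm 30, ← Nat.mul_add]) (Nat.mul_le_mul_right _ hQ)
  apply runs_of_wp
  apply Wp.seq
  apply Wp.put
  apply Wp.seq
  apply Wp.assign
  set s₁ := (s.put aWin (Expr.eval s (.const 0)) (Expr.eval s (.var vC))).assign vOk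
    (Expr.eval (s.put aWin (Expr.eval s (.const 0)) (Expr.eval s (.var vC))) (.const 1)) with hs₁
  have A₁ : Agree [vOk] [aWin] s s₁ := ((Agree.refl _ _ _).put (by simp)).assign (by simp)
  have hok₁ : s₁.var vOk ≠ 0 := by simp [hs₁, Expr.eval]
  have hw₁ : ∀ j < 2 * k + 3, s₁.arr aWin j = (c :: H head).getD j 0 := by
    intro j hj
    cases j with
    | zero => simp [hs₁, Expr.eval, hc]
    | succ j => simpa [hs₁, Expr.eval] using hw j (by omega)
  apply Wp.seq
  refine (freshCheck_runs (s := s₁) (hN.agree A₁ (by simp)) hS.root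
    (by rw [A₁.var _ (by simp), hH]; exact hh)).wp ?_
  rintro s₂ t₂ ⟨A₂, hok₂⟩ ht₂
  rw [A₁.var vC (by simp), A₁.var vHead (by simp), hc, hH] at hok₂
  have B₂ : Agree [vX, vOk] [aWin] s s₂ := (A₁.mono (by simp) (by simp)).trans (A₂.mono (by simp) (by simp))
  apply Wp.seq
  refine (closeCheck_runs (s := s₂) (g := c :: H head) (hE.agree B₂ (by simp) (by simp))
    (by rw [A₂.arr _ (by simp)]; exact hw₁) (by simpa using hV.getD_le k)).wp ?_
  rintro s₃ t₃ ⟨A₃, hok₃⟩ ht₃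
  have B₃ : Agree [vX, vI, vOk] [aWin] s s₃ :=
    (B₂.mono (by simp) (by simp)).trans (A₃.mono (by simp) (by simp))
  have hext : s₃.var vOk ≠ 0 ↔ Extends G k D lev (H head) c := by
    rw [hok₃, hok₂]
    exact ⟨fun h => ⟨hcn, hp, h.1.2, h.2⟩, fun h => ⟨⟨hok₁, h.fresh⟩, h.closes⟩⟩
  have hw₃ : ∀ j < 2 * k + 3, s₃.arr aWin j = (c :: H head).getD j 0 := by
    rw [A₃.arr _ (by simp), A₂.arr _ (by simp)]; exact hw₁
  simp only [Expr.cost] at ht₂ ht₃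
  -- the invariant after a run that does not create a node
  have finish : ∀ {vs : List ℕ} {s' : State}, Agree vs [] s₃ s' →
      (∀ x ∈ [vN, vK, vCol, vWin, vEnd, vD, vTot, vHead, vC], x ∉ vs) →
      Search G k r D lev H tot head (c + 1) (s'.var vAns) →
      ∃ H' tot', Ready G k r D lev H' tot' head (c + 1) s' ∧
        tot ≤ tot' ∧ (∀ q < tot, H' q = H q) ∧ s'.var vC = c ∧
        ∀ j < 2 * k + 2, s'.arr aWin (j + 1) = (H head).getD j 0 := by
    intro vs s' A hvs hS'
    refine ⟨H, tot, ⟨?_, ?_, ?_, ?_, hS'⟩, le_rfl, fun _ _ => rfl, ?_, ?_⟩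
    · exact (hE.agree B₃ (by simp) (by simp)).agree A
        (fun x hx => hvs x (by simp at hx ⊢; omega)) (by simp)
    · exact (hN.agree B₃ (by simp)).agree A (by simp)
    · rw [A.var _ (hvs _ (by simp)), B₃.var _ (by simp), hT]
    · rw [A.var _ (hvs _ (by simp)), B₃.var _ (by simp), hH]
    · rw [A.var _ (hvs _ (by simp)), B₃.var _ (by simp), hc]
    · intro j hj
      rw [A.arr _ (by simp), hw₃ (j + 1) (by omega)]
      simp
  apply Wp.cond
  swap
  · intro hb
    apply Wp.skip
    refine ⟨by simp only [Expr.cost, expandTime]; omega, finish (Agree.refl [] [] _) (by simp) ?_⟩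
    rw [B₃.var _ (by simp)]
    refine hS.skip fun h => hext.2 h ?_
    simpa [Expr.eval] using hb
  intro hb
  have he := hext.1 (by simpa [Expr.eval] using hb)
  have hN₃ := hN.agree B₃ (by simp)
  have hH₃ : s₃.var vHead = head := by rw [B₃.var _ (by simp), hH]
  have hC₃ : s₃.var vC = c := by rw [B₃.var _ (by simp), hc]
  apply Wp.seq
  refine (attributes_runs (hE.agree B₃ (by simp) (by simp)) hN₃ (by rw [hH₃]; exact hh)).wp ?_
  rintro s₄ t₄ ⟨A₄, hlen, hplaced, hgap, hnew, hrow⟩ ht₄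
  rw [hH₃, hC₃] at hlen hplaced hgap hnew hrow
  simp only [Expr.cost] at ht₄
  have hans₄ : s₄.var vAns = s.var vAns := by rw [A₄.var _ (by simp), B₃.var _ (by simp)]
  have hE₄ := (hE.agree B₃ (by simp) (by simp)).agree A₄ (by simp) (by simp)
  have hN₄ := hN₃.agree A₄ (by simp)
  have hT₄ : s₄.var vTot = tot := by rw [A₄.var _ (by simp), B₃.var _ (by simp), hT]
  have hcomp : (Expr.and (.le (.var vN) (.var vPlaced)) (.le (.var vCol) (.var vGap))).eval s₄ ≠ 0 ↔
      Complete n k (c :: H head) := by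
    rw [ne_eq, Expr.eval_and, Expr.eval_le, Expr.eval_le]
    simp only [Expr.eval, hplaced, hgap, hE₄.n_eq, hE₄.col_eq, Complete]
    tauto
  apply Wp.cond
  · intro hb
    have hcc := hcomp.1 hb
    apply Wp.cond
    · intro hb
      rw [ne_eq, Expr.eval_lt, not_not] at hb
      simp only [Expr.eval, hlen, hE₄.end_eq, List.length_cons] at hb
      apply Wp.assign
      refine ⟨by simp [Expr.cost, expandTime]; omega, finish (A₄.mono (vs' := [vLen, vPlaced, vGap, vNew, vRow, vAns])
        (as' := []) (by simp) (by simp) |>.assign (by simp)) (by simp) ?_⟩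
      simpa [Expr.eval] using hS.accept hh he hcc hb
    · intro hb
      rw [Expr.eval_lt] at hb
      simp only [Expr.eval, hlen, hE₄.end_eq, List.length_cons] at hb
      apply Wp.skip
      refine ⟨by simp [Expr.cost, expandTime]; omega, finish A₄ (by simp) ?_⟩
      rw [hans₄]
      exact hS.reject hcc hb
  · intro hb
    have hcc : ¬ Complete n k (c :: H head) := fun h => hcomp.2 h hb
    apply Wp.seq
    refine (duplicateCheck_runs (g := c :: H head) hN₄ hE₄.win_eq hT₄ hrow (fun j hj => by
      rw [A₄.arr _ (by simp)]; exact hw₃ j (by omega))).wp ?_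
    rintro s₅ t₅ ⟨A₅, hok₅⟩ ht₅
    simp only [Expr.cost, Expr.cost_and, Expr.cost_le] at ht₅
    have B₅ : Agree [vLen, vPlaced, vGap, vNew, vRow, vZ, vX, vI, vSame, vOk] [] s₃ s₅ :=
      (A₄.mono (by simp) (by simp)).trans (A₅.mono (by simp) (by simp))
    have hok₄ : s₄.var vOk ≠ 0 := by rw [A₄.var _ (by simp)]; exact hext.2 he
    apply Wp.cond
    · intro hb
      simp only [Expr.eval] at hb
      have hd := (hok₅.1 hb).2
      have hT₅ : s₅.var vTot = tot := by rw [A₅.var _ (by simp), hT₄]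
      have hC₅ : s₅.var vC = c := by rw [B₅.var _ (by simp), hC₃]
      have hH₅ : s₅.var vHead = head := by rw [B₅.var _ (by simp), hH₃]
      refine (push_runs (g := c :: H head) (hN₄.agree A₅ (by simp)) hT₅ (by omega)
        (by rw [hC₅, hH₅]) (by rw [A₅.var _ (by simp), hlen]) (by rw [A₅.var _ (by simp), hplaced])
        (by rw [A₅.var _ (by simp), hgap]) (by rw [A₅.var _ (by simp), hnew])
        (by rw [A₅.var _ (by simp), hrow])).wp ?_
      rintro s₆ t₆ ⟨A₆, hT₆, hN₆⟩ ht₆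
      simp only [Expr.cost] at ht₆
      refine ⟨by simp only [expandTime]; omega, _, _,
        ⟨(hE₄.agree A₅ (by simp) (by simp)).agree A₆ (by simp) (by simp), hN₆, hT₆, ?_, ?_⟩,
        Nat.le_succ _, fun q hq => Function.update_of_ne (by omega) _ _, ?_, ?_⟩
      · rw [A₆.var _ (by simp), hH₅]
      · rw [A₆.var _ (by simp), A₅.var _ (by simp), hans₄]
        exact hS.push hh he hcc hd
      · rw [A₆.var _ (by simp), hC₅]
      · intro j hj
        rw [A₆.arr _ (by simp), B₅.arr _ (by simp), hw₃ (j + 1) (by omega)]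
        simp
    · intro hb
      simp only [Expr.eval] at hb
      apply Wp.skip
      refine ⟨by simp only [Expr.cost, expandTime]; omega, finish B₅ (by simp) ?_⟩
      rw [A₅.var _ (by simp), hans₄]
      have : ∃ z < tot, SameWindow k (H z) (c :: H head) := by
        by_contra hno
        push Not at hno
        exact hok₅.2 ⟨hok₄, hno⟩ hb
      obtain ⟨z, hz, hzw⟩ := this
      exact hS.duplicate hh hcc hz hzw

end GridSearch

/-! ### Visiting a node, one search, and the loop over `D` -/

namespace GridSearch

open RAM History

variable {n : ℕ} {G : SimpleGraph (Fin n)} {k r D : ℕ} {lev : ℕ → ℕ} {s s' : State}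
variable {H : ℕ → List ℕ} {tot head c : ℕ}

theorem Ready.agree {vs : List ℕ} (h : Ready G k r D lev H tot head c s) (a : Agree vs [aWin] s s')
    (hv : ∀ x ∈ [vN, vK, vCol, vWin, vEnd, vD, vTot, vHead, vAns], x ∉ vs) :
    Ready G k r D lev H tot head c s' := by
  refine ⟨h.env.agree a (fun x hx => hv x (by simp at hx ⊢; omega)) (by simp),
    h.nodes.agree a (by simp), ?_, ?_, ?_⟩
  · rw [a.var _ (hv _ (by simp)), h.tot_eq]
  · rw [a.var _ (hv _ (by simp)), h.head_eq]
  · rw [a.var vAns (hv _ (by simp))]; exact h.search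

theorem loadWindow_runs (hN : Nodes k H tot s) (hW : s.var vWin = 2 * k + 2)
    (hh : s.var vHead < tot) :
    Runs loadWindow s (40 * (2 * k + 2) + 20) fun s' => Agree [vX, vI] [aWin] s s' ∧
      ∀ j < 2 * k + 2, s'.arr aWin (j + 1) = (H (s.var vHead)).getD j 0 := by
  apply runs_of_wp
  apply Wp.seq
  apply Wp.assign
  refine (Runs.for (m := 2 * k + 2) (fun j s' => Agree [vX, vI] [aWin] s s' ∧ s'.var vI = j ∧
      s'.var vX < tot ∧ H (s'.var vX) = (H (s.var vHead)).drop j ∧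
      ∀ i < j, s'.arr aWin (i + 1) = (H (s.var vHead)).getD i 0)
      (fun _ => 20) (P := fun s' => Agree [vX, vI] [aWin] s s' ∧
      ∀ j < 2 * k + 2, s'.arr aWin (j + 1) = (H (s.var vHead)).getD j 0) ?_ ?_ ?_ ?_).wp ?_
  · exact ⟨((Agree.refl _ _ _).assign (by simp)).assign (by simp), by simp,
      by simpa [Expr.eval] using hh, by simp [Expr.eval], by simp⟩
  · rintro j s₁ ⟨hA, hj, -⟩
    exact ⟨hj, by simp [Expr.eval, hA.var, hW]⟩
  · rintro j s₁ ⟨hA, hj, hx, hH, hI⟩ hjn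
    have hp := hN.par _ hx
    have hc := hN.con _ hx
    rw [hH] at hc hp
    have hc' : s.arr aCon (s₁.var vX) = (H (s.var vHead)).getD j 0 := by
      rw [hc]; simp [List.getD_eq_getElem?_getD]
    apply Wp.seq
    apply Wp.put
    apply Wp.assign
    refine ⟨by simp [Expr.cost], ((hA.put (by simp)).assign (by simp)).assign (by simp),
      by simp [hj], by simpa [Expr.eval, hA.arr] using hp.1,
      by simpa [Expr.eval, hA.arr] using hp.2, ?_⟩
    rw [Nat.forall_lt_succ_right]
    refine ⟨fun i hi => ?_, ?_⟩
    · simp only [State.arr_assign, State.arr_put, if_true, Expr.eval, hj]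
      rw [Function.update_of_ne (by omega), hI i hi]
    · simp only [State.arr_assign, State.arr_put, if_true, Expr.eval, hj]
      rw [Function.update_self, hA.arr _ (by simp), hc']
  · rintro s₁ ⟨hA, -, -, -, hI⟩
    exact ⟨hA, hI⟩
  · intro s₁ t h ht
    refine ⟨?_, h⟩
    simp [Expr.cost] at ht
    omega

/-- The bound for the number of nodes, if at most `β` vertices have levels in the range that
matters. -/
def nodeBound (n k β : ℕ) : ℕ := (k + 1) * ((n + 1) * (β + 1) ^ (2 * k + 2))

/-- The time for considering all children of a node that contains a vertex. -/
def visitTime (n k β : ℕ) : ℕ :=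
  40 * (2 * k + 2) + 200 * (n + 1) + 100 + (β + 1) * expandTime n k (nodeBound n k β)

theorem passes_cost : passes.cost = 65 := by simp [passes, Expr.cost]

/-- Only contents that pass the test cost `expandTime`; there are at most `β + 1` of them if the
node contains a vertex. Otherwise there is no level to compare with, and all `n + 1` contents may
pass. This surplus is a separate term because at most `k + 1` nodes incur it. -/
theorem visit_runs {β : ℕ}
    (hβ : ∀ x ∈ Finset.Icc 1 n, (near n lev ((2 * k + 2) * D) x).card ≤ β)
    (hR : Ready G k r D lev H tot head 0 s) (hh : head < tot) :
    Runs visit s (visitTime n k β +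
        if newest (H head) = 0 then (n + 1) * expandTime n k (nodeBound n k β) else 0)
      fun s' => ∃ H' tot', Ready G k r D lev H' tot' (head + 1) 0 s' ∧ tot ≤ tot' ∧
        ∀ q < tot, H' q = H q := by
  classical
  set X := expandTime n k (nodeBound n k β) with hX
  have hV := hR.search.valid head hh
  have hpass : ((Finset.range (n + 1)).filter fun c => Passes k D lev (H head) c).card * X ≤
      (β + 1) * X + if newest (H head) = 0 then (n + 1) * X else 0 := by
    split_ifs with h0
    · refine le_trans (Nat.mul_le_mul_right _ ?_) (Nat.le_add_left _ _)
      exact (Finset.card_filter_le _ _).trans (by simp)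
    · rw [add_zero]
      exact Nat.mul_le_mul_right _ (hV.card_passes_le hβ h0)
  apply runs_of_wp
  apply Wp.seq
  refine (loadWindow_runs hR.nodes hR.env.win_eq (by rw [hR.head_eq]; exact hh)).wp ?_
  rintro s₁ t₁ ⟨A₁, hw₁⟩ ht₁
  rw [hR.head_eq] at hw₁
  apply Wp.seq
  refine (Runs.for (m := n + 1) (fun c s' => s'.var vC = c ∧
      (∀ j < 2 * k + 2, s'.arr aWin (j + 1) = (H head).getD j 0) ∧
      ∃ H' tot', Ready G k r D lev H' tot' head c s' ∧ tot ≤ tot' ∧ ∀ q < tot, H' q = H q)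
      (fun c => 110 + if Passes k D lev (H head) c then X else 0)
      (P := fun s' => ∃ H' tot', Ready G k r D lev H' tot' head (n + 1) s' ∧ tot ≤ tot' ∧
        ∀ q < tot, H' q = H q) ?_ ?_ ?_ ?_).wp ?_
  · refine ⟨by simp, by simpa using hw₁, H, tot, ?_, le_rfl, fun _ _ => rfl⟩
    exact hR.agree ((A₁.mono (vs' := [vX, vI, vC]) (by simp) (fun _ => id)).assign (by simp)) (by simp)
  · rintro c s₂ ⟨hc, -, H', tot', hR', -⟩
    exact ⟨hc, by simp [Expr.eval, hR'.env.n_eq]⟩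
  · rintro c s₂ ⟨hc, hw, H', tot', hR', htt, hHH⟩ hcn
    have e := passes_eval hR' (by omega) hc
    rw [hHH head hh] at e
    apply Wp.cond
    · intro hb
      have hp : Passes k D lev (H head) c := by
        by_contra hp
        exact hb (e.2 hp)
      refine (expand_runs hR' (by omega) hc (by omega) (by rwa [hHH head hh])
        (by rwa [hHH head hh]) (hR'.search.tot_le hβ)).wp ?_
      rintro s₃ t₃ ⟨H'', tot'', hR'', htt', hHH', hc', hw'⟩ ht₃
      refine ⟨?_, by simp [hc'], ?_, H'', tot'', ?_, by omega, fun q hq => ?_⟩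
      · rw [if_pos hp, passes_cost] at *
        simp only [hX, nodeBound]
        omega
      · rw [hHH head hh] at hw'
        simpa using hw'
      · exact hR''.agree ((Agree.refl [vC] _ _).assign (by simp)) (by simp)
      · rw [hHH' q (by omega), hHH q hq]
    · intro hb
      have hp := e.1 hb
      apply Wp.skip
      refine ⟨?_, by simp [hc], by simpa using hw, H', tot', ?_, htt, hHH⟩
      · rw [if_neg hp, passes_cost]; omega
      · refine Ready.agree (s := s₂) ?_ ((Agree.refl [vC] _ _).assign (by simp)) (by simp)
        refine { hR' with search := hR'.search.skip fun he => hp ?_ }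
        have := he.passes
        rwa [hHH head hh] at this
  · rintro s₂ ⟨-, -, h⟩
    exact h
  · rintro s₂ t₂ ⟨H', tot', hR', htt, hHH⟩ ht₂
    apply Wp.assign
    refine ⟨?_, H', tot', ⟨?_, ?_, ?_, ?_, ?_⟩, htt, hHH⟩
    · rw [Finset.sum_add_distrib, Finset.sum_add_distrib, ← Finset.sum_filter, Finset.sum_const,
        Finset.sum_const, Finset.sum_const, Finset.card_range, smul_eq_mul, smul_eq_mul,
        smul_eq_mul] at ht₂
      simp only [Expr.cost, visitTime, ← hX] at ht₂ ⊢
      omega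
    · exact hR'.env.agree ((Agree.refl [vHead] [] _).assign (by simp)) (by simp) (by simp)
    · exact hR'.nodes.agree ((Agree.refl [vHead] [] _).assign (by simp)) (by simp)
    · simp [hR'.tot_eq]
    · simp [Expr.eval, hR'.head_eq]
    · simpa using hR'.search.next (by omega)

def searchTime (n k β : ℕ) : ℕ :=
  nodeBound n k β * (visitTime n k β + 10) +
    (k + 1) * ((n + 1) * expandTime n k (nodeBound n k β)) + 20

theorem search_runs {β : ℕ}
    (hβ : ∀ x ∈ Finset.Icc 1 n, (near n lev ((2 * k + 2) * D) x).card ≤ β)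
    (hE : Env G k r D lev s) (hN : Nodes k (fun _ => []) 1 s) (hans : s.var vAns = 0) :
    Runs search s (searchTime n k β) fun s' =>
      ∃ H tot, Ready G k r D lev H tot tot 0 s' := by
  classical
  set Y := (n + 1) * expandTime n k (nodeBound n k β) with hY
  set V := visitTime n k β with hVdef
  set Q := nodeBound n k β with hQ
  apply runs_of_wp
  apply Wp.seq
  apply Wp.assign
  apply Wp.seq
  apply Wp.assign
  -- `E` counts the visited nodes without a vertex. The remaining time is a potential: one share for
  -- each node that can still be visited, and one share for each surplus that can still occur.
  let E : (ℕ → List ℕ) → ℕ → ℕ := fun H head => ((Finset.range head).filter fun q => newest (H q) = 0).card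
  refine (Runs.loop (T := Q * (V + 10) + (k + 1) * Y + 10) (fun T s' => ∃ H tot head,
      Ready G k r D lev H tot head 0 s' ∧
      T = (Q - head) * (V + 10) + (k + 1 - E H head) * Y + 10) (P := fun s' =>
      ∃ H tot, Ready G k r D lev H tot tot 0 s') ?_ ?_ ?_).wp ?_
  · have A : Agree [vTot, vHead] [] s ((s.assign vTot (Expr.eval s (.const 1))).assign vHead
      (Expr.eval (s.assign vTot (Expr.eval s (.const 1))) (.const 0))) :=
      ((Agree.refl _ _ _).assign (by simp)).assign (by simp)
    refine ⟨fun _ => [], 1, 0, ⟨hE.agree A (by simp) (by simp), hN.agree A (by simp),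
      by simp [Expr.eval], by simp [Expr.eval], ?_⟩, by simp [E]⟩
    rw [A.var _ (by simp), hans]
    exact Search.initial rfl
  · rintro T s₁ ⟨H, tot, head, hR, rfl⟩ hb
    rw [ne_eq, Expr.eval_lt, not_not] at hb
    simp only [Expr.eval, hR.head_eq, hR.tot_eq] at hb
    refine (visit_runs hβ hR hb).wp ?_
    rintro s₂ t₂ ⟨H', tot', hR', htt, hHH⟩ ht₂
    refine ⟨_, ?_, H', tot', head + 1, hR', rfl⟩
    have hQ' : tot ≤ Q := hR.search.tot_le hβ
    have hEH : E H' (head + 1) = E H head + if newest (H head) = 0 then 1 else 0 := by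
      have h1 : E H' (head + 1) = E H (head + 1) := by
        simp only [E]
        congr 1
        refine Finset.filter_congr fun q hq => ?_
        rw [Finset.mem_range] at hq
        rw [hHH q (by omega)]
      rw [h1]
      simp only [E]
      rw [Finset.range_add_one, Finset.filter_insert]
      split_ifs with h0
      · rw [Finset.card_insert_of_notMem (by simp)]
      · rfl
    have hEk : E H' (head + 1) ≤ k + 1 := by
      refine le_trans (Finset.card_le_card ?_) hR'.search.card_empty_le
      refine Finset.filter_subset_filter _ (Finset.range_subset_range.2 (by omega))
    -- With the truncated differences made explicit, a visit is seen to use up one share for the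
    -- node, and one for the surplus if it occurs.
    obtain ⟨a, ha⟩ : ∃ a, Q = head + 1 + a := ⟨Q - (head + 1), by omega⟩
    obtain ⟨b, hb'⟩ : ∃ b, k + 1 = E H' (head + 1) + b := ⟨k + 1 - E H' (head + 1), by omega⟩
    have e1 : Q - head = a + 1 := by omega
    have e2 : Q - (head + 1) = a := by omega
    have e3 : k + 1 - E H' (head + 1) = b := by omega
    rw [e1, e2, e3, Nat.succ_mul]
    simp only [Expr.cost, Expr.cost_lt] at ht₂
    rw [hEH] at hb'
    split_ifs at ht₂ hb' with h0
    · have e4 : k + 1 - E H head = b + 1 := by omega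
      rw [e4, Nat.succ_mul]
      omega
    · have e4 : k + 1 - E H head = b := by omega
      rw [e4]
      omega
  · rintro T s₁ ⟨H, tot, head, hR, rfl⟩ hb
    rw [Expr.eval_lt] at hb
    simp only [Expr.eval, hR.head_eq, hR.tot_eq] at hb
    refine ⟨by simp [Expr.cost], H, tot, ?_⟩
    have := hR.search.head_le
    obtain rfl : head = tot := by omega
    exact hR
  · rintro s₁ t₁ h ht
    refine ⟨?_, h⟩
    simp only [Expr.cost, searchTime, ← hQ, ← hVdef, ← hY] at ht ⊢
    omega

/-- The loop ends at `D₀` at the latest: the search with `D₀` succeeds if there is an embedding, and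
otherwise `D₀ = n`. The bound `β` for `D₀` serves all smaller `D`, because `near` is monotone. -/
theorem searches_runs (hG : G.Connected) {β D₀ : ℕ} (hD : 1 ≤ D₀) (hDn : D₀ ≤ n)
    (hβ : ∀ x ∈ Finset.Icc 1 n, (near n lev ((2 * k + 2) * D₀) x).card ≤ β)
    (hyes : IsGridGraph G k r → ∃ h, Valid G k D₀ lev h ∧ Complete n k h ∧
      h.length < (r + 1) * (k + 1))
    (hno : ¬ IsGridGraph G k r → D₀ = n)
    (hE : ∀ D, Env G k r D lev (s.assign vD D)) (hN : Nodes k (fun _ => []) 1 s) :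
    Runs searches s (D₀ * (searchTime n k β + 30) + 50) fun s' =>
      (IsGridGraph G k r ∧ s'.var vAns = 1) ∨ (¬ IsGridGraph G k r ∧ s'.var vAns = 0) := by
  apply runs_of_wp
  apply Wp.seq
  apply Wp.assign
  apply Wp.seq
  apply Wp.assign
  set T₁ := searchTime n k β with hT₁
  refine (Runs.loop (T := D₀ * (T₁ + 30) + 40) (fun T s' => ∃ D, D ≤ D₀ ∧
      Env G k r D lev s' ∧ Nodes k (fun _ => []) 1 s' ∧
      (s'.var vAns = 0 ∨ s'.var vAns = 1 ∧ IsGridGraph G k r) ∧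
      (D = D₀ → IsGridGraph G k r → s'.var vAns = 1) ∧ T = (D₀ - D) * (T₁ + 30) + 40)
    (P := fun s' => (IsGridGraph G k r ∧ s'.var vAns = 1) ∨
      (¬ IsGridGraph G k r ∧ s'.var vAns = 0)) ?_ ?_ ?_).wp ?_
  · refine ⟨0, by omega, ?_, ?_, by simp [Expr.eval], fun h => by omega, by simp⟩
    · exact (hE 0).agree ((Agree.refl [vAns] [] _).assign (by simp)) (by simp) (by simp)
    · exact hN.agree (((Agree.refl [vD, vAns] [] _).assign (by simp)).assign (by simp)) (by simp)
  · rintro T s₁ ⟨D, hD₀, hE₁, hN₁, hans, hend, rfl⟩ hb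
    rw [ne_eq, Expr.eval_and, Expr.eval_not, Expr.eval_lt, not_or, not_not, not_not] at hb
    simp only [Expr.eval, hE₁.d_eq, hE₁.n_eq] at hb
    have hlt : D < D₀ := by
      by_contra hge
      obtain rfl : D = D₀ := by omega
      by_cases hg : IsGridGraph G k r
      · have := hend rfl hg; omega
      · have := hno hg; omega
    apply Wp.seq
    apply Wp.assign
    have A : Agree [vD] [] s₁ (s₁.assign vD (Expr.eval s₁ (.add (.var vD) (.const 1)))) :=
      (Agree.refl _ _ _).assign (by simp)
    have hD₁ : s₁.var vD = D := hE₁.d_eq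
    have hE₂ : Env G k r (D + 1) lev (s₁.assign vD (Expr.eval s₁ (.add (.var vD) (.const 1)))) :=
      { n_eq := hE₁.n_eq, adj := hE₁.adj, k_eq := hE₁.k_eq, col_eq := hE₁.col_eq
        win_eq := hE₁.win_eq, end_eq := hE₁.end_eq, lev_eq := hE₁.lev_eq
        d_eq := by simp [Expr.eval, hD₁] }
    refine (search_runs (β := β) (fun x hx => (Finset.card_le_card (near_mono
      (Nat.mul_le_mul_left _ hlt) x)).trans (hβ x hx)) hE₂ (hN₁.agree A (by simp))
      (by rw [A.var _ (by simp)]; exact hb.1)).wp ?_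
    rintro s₂ t₂ ⟨H, tot, hR⟩ ht₂
    have hpos := hR.search.pos
    have h0 := hR.search.root
    refine ⟨_, ?_, D + 1, hlt, hR.env, ?_, hR.search.sound, ?_, rfl⟩
    · obtain ⟨a, ha⟩ : ∃ a, D₀ = D + 1 + a := ⟨D₀ - (D + 1), by omega⟩
      rw [show D₀ - D = a + 1 by omega, show D₀ - (D + 1) = a by omega, Nat.succ_mul]
      simp only [Expr.cost, Expr.cost_lt, Expr.cost_and, Expr.cost_not] at ht₂
      omega
    -- Whatever nodes a search leaves behind, node `0` still describes the empty history, and the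
    -- next search needs no more.
    · have hN := hR.nodes
      constructor
      all_goals
        intro q hq
        obtain rfl : q = 0 := by omega
      · have := hN.par_le 0 hpos
        simp; omega
      · exact hN.par_le 0 hpos
      · rw [hN.con 0 hpos, h0]
      · rw [hN.len 0 hpos, h0]
      · rw [hN.placed 0 hpos, h0]
      · rw [hN.gap 0 hpos, h0]
      · rw [hN.new 0 hpos, h0]
      · rw [hN.row 0 hpos, h0]
    · rintro hDD hg
      obtain ⟨h, hv, hc, hl⟩ := hyes hg
      rw [← hDD] at hv
      exact hR.search.ans_eq_one hG hv hc hl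
  · rintro T s₁ ⟨D, hD₀, hE₁, hN₁, hans, hend, rfl⟩ hb
    refine ⟨by simp [Expr.cost], ?_⟩
    rw [Expr.eval_and, Expr.eval_not, Expr.eval_lt] at hb
    simp only [Expr.eval, hE₁.d_eq, hE₁.n_eq] at hb
    rcases hans with h0 | h1
    · right
      refine ⟨fun hg => ?_, h0⟩
      have := hend (by omega) hg
      omega
    · exact Or.inl ⟨h1.2, h1.1⟩
  · rintro s₁ t₁ h ht
    refine ⟨?_, h⟩
    simp only [Expr.cost] at ht
    omega

end GridSearch

/-! ### Constants and levels -/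

namespace GridSearch

open RAM History SimpleGraph

variable {n : ℕ} {G : SimpleGraph (Fin n)} {k r D : ℕ} {s s' : State}

theorem constants_runs (hn : s.var vN = n) (hk : s.var vK = k) (hr : s.var vR = r) :
    Runs constants s (30 * (n + k) + 100) fun s' => Agree [vCol, vWin, vEnd, vX, vI] [aOff] s s' ∧
      s'.var vCol = k + 1 ∧ s'.var vWin = 2 * k + 2 ∧ s'.var vEnd = (r + 1) * (k + 1) ∧
      ∀ c < n, s'.arr aOff (c + 1) = c * n := by
  apply runs_of_wp
  apply Wp.seq
  apply Wp.assign
  apply Wp.seq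
  apply Wp.assign
  apply Wp.seq
  apply Wp.assign
  apply Wp.seq
  refine (Runs.for (m := k + 1) (fun j s' => Agree [vCol, vWin, vEnd, vX, vI] [aOff] s s' ∧
      s'.var vI = j ∧ s'.var vCol = k + 1 ∧ s'.var vWin = 2 * k + 2 ∧ s'.var vEnd = (r + 1) * j)
      (fun _ => 10) (P := fun s' => Agree [vCol, vWin, vEnd, vX, vI] [aOff] s s' ∧
      s'.var vCol = k + 1 ∧ s'.var vWin = 2 * k + 2 ∧ s'.var vEnd = (r + 1) * (k + 1))
      ?_ ?_ ?_ ?_).wp ?_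
  · refine ⟨((((Agree.refl _ _ _).assign (by simp)).assign (by simp)).assign (by simp)).assign
      (by simp), by simp, by simp [Expr.eval, hk], ?_, by simp [Expr.eval]⟩
    simp [Expr.eval, hk]
    ring
  · rintro j s₁ ⟨-, hj, hc, -⟩
    exact ⟨hj, by simp [Expr.eval, hc]⟩
  · rintro j s₁ ⟨hA, hj, hc, hw, he⟩ hjn
    apply Wp.assign
    refine ⟨by simp [Expr.cost], (hA.assign (by simp)).assign (by simp), by simp [hj],
      by simp [hc], by simp [hw], ?_⟩
    simp [Expr.eval, he, hA.var, hr]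
    ring
  · rintro s₁ ⟨hA, -, h⟩
    exact ⟨hA, h⟩
  rintro s₁ t₁ ⟨hA₁, hc, hw, he⟩ ht₁
  apply Wp.seq
  apply Wp.assign
  refine (Runs.for (m := n) (fun j s' => Agree [vCol, vWin, vEnd, vX, vI] [aOff] s s' ∧
      s'.var vI = j ∧ s'.var vCol = k + 1 ∧ s'.var vWin = 2 * k + 2 ∧
      s'.var vEnd = (r + 1) * (k + 1) ∧ s'.var vX = j * n ∧ ∀ c < j, s'.arr aOff (c + 1) = c * n)
      (fun _ => 12) (P := fun s' => Agree [vCol, vWin, vEnd, vX, vI] [aOff] s s' ∧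
      s'.var vCol = k + 1 ∧ s'.var vWin = 2 * k + 2 ∧ s'.var vEnd = (r + 1) * (k + 1) ∧
      ∀ c < n, s'.arr aOff (c + 1) = c * n)
      ?_ ?_ ?_ ?_).wp ?_
  · refine ⟨(hA₁.assign (by simp)).assign (by simp), by simp, by simp [hc], by simp [hw],
      by simp [he], by simp [Expr.eval], by simp⟩
  · rintro j s₂ ⟨hA, hj, -⟩
    exact ⟨hj, by simp [Expr.eval, hA.var, hn]⟩
  · rintro j s₂ ⟨hA, hj, hc, hw, he, hx, hI⟩ hjn
    apply Wp.seq
    apply Wp.put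
    apply Wp.assign
    refine ⟨by simp [Expr.cost], ((hA.put (by simp)).assign (by simp)).assign (by simp), by simp [hj],
      by simp [hc], by simp [hw], by simp [he], ?_, ?_⟩
    · simp [Expr.eval, hx, hA.var, hn]
      ring
    · rw [Nat.forall_lt_succ_right]
      refine ⟨fun i hi => ?_, ?_⟩
      · simp only [State.arr_assign, State.arr_put, if_true, Expr.eval, hj]
        rw [Function.update_of_ne (by omega), hI i hi]
      · simp only [State.arr_assign, State.arr_put, if_true, Expr.eval, hj]
        rw [Function.update_self, hx]
  · rintro s₂ ⟨hA, -, hc, hw, he, -, hI⟩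
    exact ⟨hA, hc, hw, he, hI⟩
  · rintro s₂ t₂ h ht₂
    refine ⟨?_, h⟩
    simp [Expr.cost] at ht₁ ht₂
    omega

/-- The invariant of breadth first search from `s₀`: the vertices in the queue `que` before `head`
and the contents up to `i` next to the one at `head` have been considered. -/
structure Bfs (G : SimpleGraph (Fin n)) (s₀ : Fin n) (lev que : ℕ → ℕ) (head tot i : ℕ) : Prop where
  head_le : head ≤ tot
  mem : ∀ j < tot, 1 ≤ que j ∧ que j ≤ n ∧ lev (que j) ≠ 0
  surj : ∀ v : Fin n, lev (v.val + 1) ≠ 0 → ∃ j < tot, que j = v.val + 1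
  inj : ∀ i < tot, ∀ j < tot, que i = que j → i = j
  mono : ∀ i j, i ≤ j → j < tot → lev (que i) ≤ lev (que j)
  le_head : head < tot → ∀ j < tot, lev (que j) ≤ lev (que head) + 1
  done : ∀ j < head, ∀ y, ContentAdj G (que j) y → lev y ≠ 0 ∧ lev y ≤ lev (que j) + 1
  part : ∀ y ≤ i, ContentAdj G (que head) y → lev y ≠ 0 ∧ lev y ≤ lev (que head) + 1
  dist : ∀ v : Fin n, lev (v.val + 1) ≠ 0 → G.dist s₀ v + 1 ≤ lev (v.val + 1)
  root : lev (s₀.val + 1) = 1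

namespace Bfs

variable {s₀ : Fin n} {lev que : ℕ → ℕ} {head tot i : ℕ}

theorem tot_le (B : Bfs G s₀ lev que head tot i) : tot ≤ n := by
  have := Finset.card_le_card_of_injOn (s := Finset.range tot) (t := Finset.Icc 1 n) que
    (fun j hj => by
      have := B.mem j (by simpa using hj)
      simp only [Finset.coe_Icc, Set.mem_Icc]
      omega)
    (fun i hi j hj h => B.inj i (by simpa using hi) j (by simpa using hj) h)
  simpa using this

theorem initial {s₀ : Fin n} {lev que : ℕ → ℕ} (hlev : ∀ c, lev c = if c = s₀.val + 1 then 1 else 0)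
    (hque : que 0 = s₀.val + 1) : Bfs G s₀ lev que 0 1 0 where
  head_le := by omega
  mem j hj := by
    obtain rfl : j = 0 := by omega
    rw [hque, hlev, if_pos rfl]
    omega
  surj v hv := by
    refine ⟨0, by omega, ?_⟩
    rw [hlev] at hv
    split_ifs at hv with h
    · rw [hque, h]
    · simp at hv
  inj i hi j hj _ := by omega
  mono i j hij hj := by
    obtain rfl : i = j := by omega
    exact le_rfl
  le_head _ j hj := by
    obtain rfl : j = 0 := by omega
    omega
  done j hj := by omega
  part y hy h := by
    obtain ⟨u, v, -, -, rfl⟩ := h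
    omega
  dist v hv := by
    rw [hlev] at hv ⊢
    split_ifs at hv ⊢ with h
    · obtain rfl : v = s₀ := Fin.ext (by omega)
      simp
    · simp at hv
  root := by rw [hlev, if_pos rfl]

theorem skip (B : Bfs G s₀ lev que head tot i) (hh : head < tot)
    (h : ContentAdj G (que head) (i + 1) → lev (i + 1) ≠ 0) :
    Bfs G s₀ lev que head tot (i + 1) where
  __ := B
  part y hy hadj := by
    rcases (show y ≤ i ∨ y = i + 1 by omega) with h1 | rfl
    · exact B.part y h1 hadj
    · have h2 := h hadj
      obtain ⟨u, v, -, -, hv⟩ := id hadj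
      rw [hv] at h2 ⊢
      obtain ⟨j, hj, hjv⟩ := B.surj v h2
      exact ⟨h2, hjv ▸ B.le_head hh j hj⟩

theorem discover (B : Bfs G s₀ lev que head tot i) (hh : head < tot)
    (hadj : ContentAdj G (que head) (i + 1)) (h0 : lev (i + 1) = 0) :
    Bfs G s₀ (Function.update lev (i + 1) (lev (que head) + 1)) (Function.update que tot (i + 1))
      head (tot + 1) (i + 1) := by
  have eq : ∀ j < tot, Function.update que tot (i + 1) j = que j := fun j hj =>
    Function.update_of_ne (by omega) _ _
  have eq' : Function.update que tot (i + 1) tot = i + 1 := Function.update_self ..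
  have el : ∀ c, lev c ≠ 0 → Function.update lev (i + 1) (lev (que head) + 1) c = lev c := fun c hc =>
    Function.update_of_ne (by rintro rfl; exact hc h0) _ _
  have el' : Function.update lev (i + 1) (lev (que head) + 1) (i + 1) = lev (que head) + 1 :=
    Function.update_self ..
  have elq : ∀ j < tot, Function.update lev (i + 1) (lev (que head) + 1)
      (Function.update que tot (i + 1) j) = lev (que j) := fun j hj => by
    rw [eq j hj, el _ (B.mem j hj).2.2]
  have cases : ∀ q < tot + 1, q < tot ∨ q = tot := fun q hq => by omega
  have hne : ∀ j < tot, que j ≠ i + 1 := fun j hj h => (B.mem j hj).2.2 (h ▸ h0)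
  obtain ⟨u, v, huv, hu, hv⟩ := id hadj
  refine ⟨by have := B.head_le; omega, ?_, ?_, ?_, ?_, ?_, ?_, ?_, ?_, ?_⟩
  · intro j hj
    rcases cases j hj with h1 | rfl
    · rw [elq j h1, eq j h1]; exact B.mem j h1
    · rw [eq', el']; omega
  · intro w hw
    by_cases h1 : w.val + 1 = i + 1
    · exact ⟨tot, by omega, by rw [eq', h1]⟩
    · rw [Function.update_of_ne h1] at hw
      obtain ⟨j, hj, h2⟩ := B.surj w hw
      exact ⟨j, by omega, by rw [eq j hj, h2]⟩
  · intro a ha b hb h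
    rcases cases a ha with h1 | rfl <;> rcases cases b hb with h2 | rfl
    · rw [eq a h1, eq b h2] at h
      exact B.inj a h1 b h2 h
    · rw [eq a h1, eq'] at h
      exact absurd h (hne a h1)
    · rw [eq b h2, eq'] at h
      exact absurd h.symm (hne b h2)
    · rfl
  · intro a b hab hb
    rcases cases b hb with h2 | rfl
    · rw [elq a (by omega), elq b h2]
      exact B.mono a b hab h2
    · rcases cases a (by omega) with h1 | rfl
      · rw [elq a h1, eq', el']
        exact B.le_head hh a h1
      · exact le_rfl
  · intro _ j hj
    rw [elq head hh]
    rcases cases j hj with h1 | rfl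
    · rw [elq j h1]
      exact B.le_head hh j h1
    · rw [eq', el']
  · intro j hj y hy
    rw [eq j (by omega)] at hy
    have := B.done j hj y hy
    rw [elq j (by omega), el y this.1]
    exact this
  · intro y hy h
    rw [eq head hh] at h
    rw [elq head hh]
    rcases Nat.le_succ_iff.1 hy with h1 | rfl
    · have := B.part y h1 h
      rw [el y this.1]
      exact this
    · rw [el']; omega
  · intro w hw
    by_cases h1 : w.val + 1 = i + 1
    · rw [h1, el']
      obtain rfl : w = v := Fin.ext (by omega)
      have h2 := B.dist u (by rw [← hu]; exact (B.mem head hh).2.2)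
      have h3 := huv.reachable.dist_triangle_right s₀
      rw [dist_eq_one_iff_adj.2 huv] at h3
      rw [hu]
      omega
    · rw [Function.update_of_ne h1] at hw ⊢
      exact B.dist w hw
  · rw [el _ (by rw [B.root]; omega), B.root]

theorem next (B : Bfs G s₀ lev que head tot n) (hh : head < tot) :
    Bfs G s₀ lev que (head + 1) tot 0 where
  __ := B
  head_le := hh
  le_head h j hj := (B.le_head hh j hj).trans
    (Nat.add_le_add_right (B.mono head (head + 1) (by omega) h) 1)
  done j hj y hy := by
    rcases Nat.lt_succ_iff_lt_or_eq.1 hj with h1 | rfl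
    · exact B.done j h1 y hy
    · obtain ⟨u, v, -, -, rfl⟩ := id hy
      exact B.part _ (by omega) hy
  part y hy h := by
    obtain ⟨u, v, -, -, rfl⟩ := h
    omega

/-- The invariant `dist` is the lower bound. Along a shortest path each edge raises the level by at
most one, by `done`; this gives the upper bound and shows that every vertex is discovered. -/
theorem lev_eq (hG : G.Connected) (B : Bfs G s₀ lev que tot tot i) (v : Fin n) :
    lev (v.val + 1) = G.dist s₀ v + 1 := by
  have walk : ∀ {a b : Fin n} (p : G.Walk a b), lev (a.val + 1) ≠ 0 →
      lev (b.val + 1) ≠ 0 ∧ lev (b.val + 1) ≤ lev (a.val + 1) + p.length := by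
    intro a b p
    induction p with
    | nil => intro h; simp [h]
    | @cons x y z hab q ih =>
      intro h
      obtain ⟨j, hj, h1⟩ := B.surj x h
      have h2 := B.done j hj (y.val + 1) ⟨x, y, hab, h1, rfl⟩
      have h3 := ih h2.1
      rw [h1] at h2
      rw [Walk.length_cons]
      omega
  obtain ⟨p, hp⟩ := hG.exists_walk_length_eq_dist s₀ v
  have h1 := walk p (by rw [B.root]; omega)
  have h2 := B.dist v h1.1
  rw [B.root, hp] at h1
  omega

end Bfs

/-- Level `0`, the initial content of memory, marks undiscovered vertices. The root therefore has
level `1`, and levels exceed distances by one. -/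
theorem levels_runs (hG : G.Connected) (hT : Table G s) (hlev : ∀ c, s.arr aLev c = 0) (hn : 0 < n) :
    Runs levels s (n * (n * 60 + 40) + 50) fun s' =>
      Agree [vTot, vHead, vX, vI] [aLev, aQue] s s' ∧
      ∀ v : Fin n, s'.arr aLev (v.val + 1) = G.dist ⟨0, hn⟩ v + 1 := by
  apply runs_of_wp
  apply Wp.seq
  apply Wp.put
  apply Wp.seq
  apply Wp.put
  apply Wp.seq
  apply Wp.assign
  apply Wp.seq
  apply Wp.assign
  refine (Runs.loop (T := n * (n * 60 + 40) + 20) (fun T s' => ∃ head tot,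
      Agree [vTot, vHead, vX, vI] [aLev, aQue] s s' ∧ s'.var vHead = head ∧ s'.var vTot = tot ∧
      Bfs G ⟨0, hn⟩ (s'.arr aLev) (s'.arr aQue) head tot 0 ∧ T = (n - head) * (n * 60 + 40) + 20)
    (P := fun s' => Agree [vTot, vHead, vX, vI] [aLev, aQue] s s' ∧
      ∀ v : Fin n, s'.arr aLev (v.val + 1) = G.dist ⟨0, hn⟩ v + 1) ?_ ?_ ?_).wp ?_
  · refine ⟨0, 1, ((((Agree.refl _ _ _).put (by simp)).put (by simp)).assign (by simp)).assign
      (by simp), by simp [Expr.eval], by simp [Expr.eval], Bfs.initial ?_ ?_, by simp⟩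
    · intro c
      simp [Expr.eval, Function.update_apply, hlev]
    · simp [Expr.eval]
  · rintro T s₁ ⟨head, tot, hA, hh, ht, hB, rfl⟩ hb
    rw [ne_eq, Expr.eval_lt, not_not] at hb
    simp only [Expr.eval, hh, ht] at hb
    have htn := hB.tot_le
    apply Wp.seq
    apply Wp.seq
    apply Wp.assign
    refine (Runs.for (m := n) (fun i s' => ∃ tot,
      Agree [vTot, vHead, vX, vI] [aLev, aQue] s s' ∧ s'.var vI = i ∧ s'.var vHead = head ∧
      s'.var vTot = tot ∧ head < tot ∧ s'.var vX = s'.arr aQue head ∧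
      Bfs G ⟨0, hn⟩ (s'.arr aLev) (s'.arr aQue) head tot i)
      (fun _ => 45) (P := fun s' => ∃ tot,
      Agree [vTot, vHead, vX, vI] [aLev, aQue] s s' ∧ s'.var vHead = head ∧
      s'.var vTot = tot ∧ head < tot ∧
      Bfs G ⟨0, hn⟩ (s'.arr aLev) (s'.arr aQue) head tot n) ?_ ?_ ?_ ?_).wp ?_
    · refine ⟨tot, (hA.assign (by simp)).assign (by simp), by simp, by simp [hh], by simp [ht], hb,
        by simp [Expr.eval, hh], by simpa using hB⟩
    · rintro i s₂ ⟨tot, hA, hi, -⟩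
      exact ⟨hi, by simp [Expr.eval, hA.var, hT.n_eq]⟩
    · rintro i s₂ ⟨tot, hA, hi, hh, ht, hlt, hx, hB⟩ hin
      have hq := hB.mem head hlt
      have hadj := hT.adj _ hq.1 hq.2.1 i hin
      have ha0 := hA.arr aAdj (by simp)
      have ha1 := hA.arr aOff (by simp)
      apply Wp.cond
      · intro hb
        rw [ne_eq, Expr.eval_and, Expr.eval_not, not_or, not_not] at hb
        simp only [Expr.eval, hi, hx, ha0, ha1] at hb
        apply Wp.seq
        apply Wp.put
        apply Wp.seq
        apply Wp.put
        apply Wp.assign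
        refine ⟨by simp [Expr.cost], tot + 1, (((hA.put (by simp)).put (by simp)).assign
          (by simp)).assign (by simp), by simp [hi], by simp [hh], by simp [Expr.eval, ht],
          by omega, ?_, ?_⟩
        · simp [Expr.eval, hx, ht]
          rw [Function.update_of_ne (by omega)]
        · have := hB.discover hlt (hadj.1 hb.1) hb.2
          simpa [Expr.eval, hi, hx, ht] using this
      · intro hb
        rw [Expr.eval_and, Expr.eval_not] at hb
        simp only [Expr.eval, hi, hx, ha0, ha1] at hb
        apply Wp.skip
        refine ⟨by simp [Expr.cost], tot, hA.assign (by simp), by simp [hi], by simp [hh],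
          by simp [ht], hlt, by simp [hx], ?_⟩
        exact hB.skip hlt fun h => hb.resolve_left (hadj.2 h)
    · rintro s₂ ⟨tot, hA, -, hh, ht, hlt, -, hB⟩
      exact ⟨tot, hA, hh, ht, hlt, hB⟩
    · rintro s₂ t₂ ⟨tot', hA₂, hh₂, ht₂, hlt, hB₂⟩ htime
      apply Wp.assign
      refine ⟨_, ?_, head + 1, tot', hA₂.assign (by simp), by simp [Expr.eval, hh₂],
        by simp [ht₂], by simpa using hB₂.next hlt, rfl⟩
      obtain ⟨a, ha⟩ : ∃ a, n = head + 1 + a := ⟨n - (head + 1), by omega⟩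
      rw [show n - head = a + 1 by omega, show n - (head + 1) = a by omega, Nat.succ_mul]
      simp [Expr.cost] at htime ⊢
      omega
  · rintro T s₁ ⟨head, tot, hA, hh, ht, hB, rfl⟩ hb
    rw [Expr.eval_lt] at hb
    simp only [Expr.eval, hh, ht] at hb
    have := hB.head_le
    obtain rfl : head = tot := by omega
    exact ⟨by simp [Expr.cost], hA, hB.lev_eq hG⟩
  · rintro s₁ t₁ h ht
    refine ⟨?_, h⟩
    simp [Expr.cost] at ht
    omega

end GridSearch

/-! ### The total running time -/

namespace GridSearch

open RAM History SimpleGraph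

/-- The time of the program if the search succeeds, or may stop, with parameter `D₀`. -/
def programTime (n k β D₀ : ℕ) : ℕ :=
  30 * (n + k) + n * (n * 60 + 40) + D₀ * (searchTime n k β + 30) + 210

theorem table_of_encode (I : GridInstance) {s : State} (hn : s.var vN = I.n)
    (ha : s.arr aAdj = I.encode.arr aAdj) (ho : ∀ c < I.n, s.arr aOff (c + 1) = c * I.n) :
    Table I.graph s := by
  refine ⟨hn, fun c hc hcn y hy => ?_⟩
  obtain ⟨c, rfl⟩ : ∃ d, c = d + 1 := ⟨c - 1, by omega⟩
  rw [ho c (by omega), ha]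
  simp only [GridInstance.encode, true_and, ne_eq, ite_eq_right_iff, one_ne_zero, imp_false, not_not]
  constructor
  · rintro ⟨u, v, h, huv⟩
    have hn0 : 0 < I.n := by omega
    have h1 : c = u := by
      have := congrArg (· / I.n) h
      simpa [Nat.mul_comm _ I.n, Nat.mul_add_div hn0, Nat.div_eq_of_lt hy, Nat.div_eq_of_lt v.2]
        using this
    refine ⟨u, v, huv, by omega, ?_⟩
    rw [h1] at h
    omega
  · rintro ⟨u, v, huv, h1, h2⟩
    exact ⟨u, v, by rw [show c = u.val by omega, show y = v.val by omega], huv⟩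

/-- The hypotheses range over all functions `lev` with the right values at vertices, because the
level array arises during the run and its other cells are left unspecified. -/
theorem program_decides (I : GridInstance) {β D₀ : ℕ} (hD : 1 ≤ D₀) (hDn : D₀ ≤ I.n)
    (s₀ : Fin I.n) (hs₀ : s₀.val = 0)
    (hβ : ∀ lev : ℕ → ℕ, (∀ v : Fin I.n, lev (v.val + 1) = I.graph.dist s₀ v + 1) →
      ∀ x ∈ Finset.Icc 1 I.n, (near I.n lev ((2 * I.k + 2) * D₀) x).card ≤ β)
    (hyes : I.IsYes → ∀ lev : ℕ → ℕ, (∀ v : Fin I.n, lev (v.val + 1) = I.graph.dist s₀ v + 1) →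
      ∃ h, Valid I.graph I.k D₀ lev h ∧ Complete I.n I.k h ∧ h.length < (I.r + 1) * (I.k + 1))
    (hno : ¬ I.IsYes → D₀ = I.n) :
    DecidesWithin program I.encode I.IsYes (programTime I.n I.k β D₀) := by
  have hn : 0 < I.n := by have := s₀.2; omega
  obtain rfl : s₀ = ⟨0, hn⟩ := Fin.ext hs₀
  have e0 : I.encode.var vN = I.n := by simp [GridInstance.encode]
  have e1 : I.encode.var vK = I.k := by simp [GridInstance.encode]
  have e2 : I.encode.var vR = I.r := by simp [GridInstance.encode]
  have ea : ∀ a ≠ 0, ∀ i, I.encode.arr a i = 0 := fun a ha i => by simp [GridInstance.encode, ha]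
  suffices Runs program I.encode (programTime I.n I.k β D₀) fun s' =>
      (I.IsYes ∧ s'.var 0 = 1) ∨ (¬ I.IsYes ∧ s'.var 0 = 0) by
    obtain ⟨s', t, h1, h2, h3⟩ := this
    exact ⟨s', t, h1, h2, h3⟩
  apply runs_of_wp
  apply Wp.seq
  refine (constants_runs e0 e1 e2).wp ?_
  rintro s₁ t₁ ⟨A₁, hc, hw, he, ho⟩ ht₁
  have hT : Table I.graph s₁ := table_of_encode I (by rw [A₁.var _ (by simp), e0])
    (A₁.arr _ (by simp)) ho
  apply Wp.seq
  refine (levels_runs I.connected hT (fun c => by rw [A₁.arr _ (by simp)]; exact ea _ (by simp) c)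
    hn).wp ?_
  rintro s₂ t₂ ⟨A₂, hlev⟩ ht₂
  apply Wp.seq
  refine (searches_runs (lev := s₂.arr aLev) (r := I.r) I.connected hD hDn (hβ _ hlev)
    (fun hg => hyes hg _ hlev) hno ?_ ?_).wp ?_
  · intro D
    have hT₂ : Table I.graph (s₂.assign vD D) := hT.agree
      ((A₂.mono (vs' := [vTot, vHead, vX, vI, vD]) (by simp) (fun _ => id)).assign (by simp))
      (by simp) (by simp)
    exact { hT₂ with
      k_eq := by simp [A₂.var, A₁.var, e1]
      col_eq := by simp [A₂.var, hc]
      win_eq := by simp [A₂.var, hw]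
      end_eq := by simp [A₂.var, he]
      d_eq := by simp
      lev_eq := rfl }
  · have z : ∀ a ∈ [aPar, aCon, aLen, aPlaced, aGap, aNew, aRow], ∀ i, s₂.arr a i = 0 := by
      intro a ha i
      simp only [List.mem_cons, List.not_mem_nil, or_false] at ha
      rw [A₂.arr _ (by simp; omega), A₁.arr _ (by simp; omega), ea a (by omega)]
    constructor
    all_goals
      intro q hq
      rw [z _ (by simp)]
      simp [placed, gap, newest, row]
  · rintro s₃ t₃ h ht₃
    apply Wp.assign
    refine ⟨?_, by simpa [Expr.eval, GridInstance.IsYes] using h⟩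
    simp only [Expr.cost, programTime] at ht₁ ht₂ ht₃ ⊢
    omega

/-- Up to constants there are `m` searches, `Q` nodes in each, `B = 21 * m ^ 3` expansions per node,
and `m * Q` steps per expansion. Since `Q ≤ 4 * (m * n * B ^ (2 * k + 2))`, the square of `Q`
supplies `n ^ 2` and `49600 = 16 * 3100`. The rest is absorbed by `m ^ 4 ≤ B ^ 2` and `4 * k + 7 ≤
11 * k`. -/
theorem programTime_le {n k β D₀ m : ℕ} (hn : 1 ≤ n) (hk : 1 ≤ k) (hkm : k ≤ m) (hD : D₀ ≤ m)
    (hβ : β + 1 ≤ 21 * m ^ 3) :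
    programTime n k β D₀ ≤ 49600 * (n ^ 2 * (21 * m ^ 3) ^ (11 * k)) := by
  have hm : 1 ≤ m := hk.trans hkm
  set B := 21 * m ^ 3 with hB
  set Q := nodeBound n k β with hQ
  set X := expandTime n k Q with hX
  have hB1 : 1 ≤ B := by omega
  have hpow : 1 ≤ (β + 1) ^ (2 * k + 2) := Nat.one_le_pow _ _ (by omega)
  have hkn : (k + 1) * (n + 1) ≤ Q := by
    rw [hQ, nodeBound]
    exact Nat.mul_le_mul_left _ (Nat.le_mul_of_pos_right _ hpow)
  have hnQ : n + 1 ≤ Q := (Nat.le_mul_of_pos_left _ (by omega)).trans hkn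
  have hkQ : k + 1 ≤ Q := (Nat.le_mul_of_pos_right _ (by omega)).trans hkn
  have hQ' : Q ≤ 4 * (m * n * B ^ (2 * k + 2)) := by
    have h1 : (β + 1) ^ (2 * k + 2) ≤ B ^ (2 * k + 2) := Nat.pow_le_pow_left hβ _
    calc Q ≤ (2 * m) * ((2 * n) * B ^ (2 * k + 2)) :=
          Nat.mul_le_mul (by omega) (Nat.mul_le_mul (by omega) h1)
      _ = _ := by ring
  have hmQ : Q ≤ m * Q := Nat.le_mul_of_pos_left _ hm
  have hkmQ : k * Q ≤ m * Q := Nat.mul_le_mul_right _ hkm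
  have hX1 : X ≤ 960 * (m * Q) := by
    have : X = 80 * (k * Q) + 170 * Q + 110 * n + 600 := by rw [hX, expandTime]; ring
    omega
  have hBmQ : m * Q ≤ B * (m * Q) := Nat.le_mul_of_pos_left _ hB1
  have hV : visitTime n k β ≤ 1620 * (B * (m * Q)) := by
    have h1 : (β + 1) * X ≤ 960 * (B * (m * Q)) := by
      calc (β + 1) * X ≤ B * (960 * (m * Q)) := Nat.mul_le_mul hβ hX1
        _ = _ := by ring
    rw [visitTime, ← hQ, ← hX]
    omega
  have hQ2 : Q * (m * Q) ≤ Q * (B * (m * Q)) := Nat.mul_le_mul_left _ hBmQ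
  have hQ3 : Q ≤ Q * (m * Q) := Nat.le_mul_of_pos_right _ (by omega)
  have hS : searchTime n k β ≤ 2620 * (Q * (B * (m * Q))) := by
    have h1 : Q * (visitTime n k β + 10) ≤ 1630 * (Q * (B * (m * Q))) := by
      calc Q * (visitTime n k β + 10) ≤ Q * (1630 * (B * (m * Q))) := Nat.mul_le_mul_left _ (by omega)
        _ = _ := by ring
    have h2 : (k + 1) * ((n + 1) * X) ≤ 960 * (Q * (m * Q)) := by
      calc (k + 1) * ((n + 1) * X) = ((k + 1) * (n + 1)) * X := by ring
        _ ≤ Q * (960 * (m * Q)) := Nat.mul_le_mul hkn hX1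
        _ = _ := by ring
    rw [searchTime, ← hQ, ← hX]
    omega
  set Z := Q * (B * (m * Q)) with hZ
  have hmZ : Z ≤ m * Z := Nat.le_mul_of_pos_left _ hm
  have hP : programTime n k β D₀ ≤ 3100 * (m * Z) := by
    have h1 : D₀ * (searchTime n k β + 30) ≤ 2650 * (m * Z) := by
      calc D₀ * (searchTime n k β + 30) ≤ m * (2650 * Z) := Nat.mul_le_mul hD (by omega)
        _ = _ := by ring
    have h2 : n * n ≤ m * Z := by
      calc n * n ≤ Q * (m * Q) := Nat.mul_le_mul (by omega) (by omega)
        _ ≤ m * Z := by omega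
    have h3 : n * (n * 60 + 40) = 60 * (n * n) + 40 * n := by ring
    rw [programTime, h3]
    omega
  refine hP.trans ?_
  have hmB : m ^ 4 ≤ B ^ 2 := by
    calc m ^ 4 ≤ (m ^ 3) ^ 2 := by rw [← pow_mul]; exact Nat.pow_le_pow_right hm (by omega)
      _ ≤ B ^ 2 := Nat.pow_le_pow_left (by omega) _
  calc 3100 * (m * Z) = 3100 * (m ^ 2 * B * (Q * Q)) := by rw [hZ]; ring
    _ ≤ 3100 * (m ^ 2 * B * (4 * (m * n * B ^ (2 * k + 2)) * (4 * (m * n * B ^ (2 * k + 2))))) := by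
        gcongr
    _ = 49600 * (n ^ 2 * (m ^ 4 * B ^ (4 * k + 5))) := by ring
    _ ≤ 49600 * (n ^ 2 * (B ^ 2 * B ^ (4 * k + 5))) := by gcongr
    _ = 49600 * (n ^ 2 * B ^ (4 * k + 7)) := by rw [← pow_add]; congr 3; omega
    _ ≤ 49600 * (n ^ 2 * B ^ (11 * k)) := by gcongr; omega

/-- A constant that serves in the exponent, too. -/
def timeConst : ℕ := 49600 * 168 ^ 11

/-- The base `b = k * max 1 a` equals `1` if `k = 1` and `a ≤ 1`; then its powers are of no use, and
the left side is bounded by means of `21 * 2 ^ 3 = 168`. Otherwise `b ≥ 2`, so `21 ≤ b ^ 5` and `a +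
k ≤ 2 * b ≤ b ^ 2`, whence `21 * (a + k) ^ 3 ≤ b ^ 11`. -/
theorem pow_le_timeConst {n k a : ℕ} (hk : 1 ≤ k) :
    49600 * (n ^ 2 * (21 * (a + k) ^ 3) ^ (11 * k)) ≤
      timeConst * (n ^ 2 * (k * max 1 a) ^ (timeConst * (k * a + k ^ 2))) := by
  have hC : 121 ≤ timeConst := by norm_num [timeConst]
  have hC' : 49600 ≤ timeConst := by norm_num [timeConst]
  have hC'' : 49600 * 168 ^ 11 = timeConst := rfl
  generalize timeConst = C at *
  by_cases h : k = 1 ∧ a ≤ 1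
  · obtain ⟨rfl, ha⟩ := h
    have h1 : (21 * (a + 1) ^ 3) ^ (11 * 1) ≤ 168 ^ 11 := by
      refine Nat.pow_le_pow_left ?_ _
      have : (a + 1) ^ 3 ≤ 2 ^ 3 := Nat.pow_le_pow_left (by omega) _
      omega
    rw [show 1 * max 1 a = 1 by omega, one_pow (C * _), mul_one (n ^ 2)]
    calc 49600 * (n ^ 2 * (21 * (a + 1) ^ 3) ^ (11 * 1)) ≤ 49600 * (n ^ 2 * 168 ^ 11) := by gcongr
      _ = C * n ^ 2 := by rw [← hC'']; ring
  · set b := k * max 1 a with hb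
    have hkb : k ≤ b := Nat.le_mul_of_pos_right _ (by omega)
    have hab : a ≤ b := (le_max_right 1 a).trans (Nat.le_mul_of_pos_left _ hk)
    have hb2 : 2 ≤ b := by omega
    have hm : a + k ≤ b ^ 2 := by nlinarith
    have h21 : 21 ≤ b ^ 5 := le_trans (by norm_num) (Nat.pow_le_pow_left hb2 5)
    have hB : 21 * (a + k) ^ 3 ≤ b ^ 11 := by
      calc 21 * (a + k) ^ 3 ≤ b ^ 5 * (b ^ 2) ^ 3 := by gcongr
        _ = b ^ 11 := by ring
    have hexp : 11 * (11 * k) ≤ C * (k * a + k ^ 2) := by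
      have : k ≤ k ^ 2 := Nat.le_self_pow (by omega) _
      calc 11 * (11 * k) = 121 * k := by ring
        _ ≤ C * (k * a + k ^ 2) := Nat.mul_le_mul hC (by omega)
    refine Nat.mul_le_mul hC' (Nat.mul_le_mul_left _ ?_)
    calc (21 * (a + k) ^ 3) ^ (11 * k) ≤ (b ^ 11) ^ (11 * k) := Nat.pow_le_pow_left hB _
      _ = b ^ (11 * (11 * k)) := by rw [← pow_mul]
      _ ≤ _ := Nat.pow_le_pow_right (by omega) hexp

theorem DecidesWithin.mono {p : Prog} {s : State} {A : Prop} {T T' : ℕ}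
    (h : DecidesWithin p s A T) (hT : T ≤ T') : DecidesWithin p s A T' := by
  obtain ⟨s', t, h1, h2, h3⟩ := h
  exact ⟨s', t, h1, h2.trans hT, h3⟩

theorem program_decidesWithin (I : GridInstance) :
    DecidesWithin program I.encode I.IsYes
      (timeConst * (I.n ^ 2 * (I.k * max 1 I.aG) ^ (timeConst * (I.k * I.aG + I.k ^ 2)))) := by
  have hn : 0 < I.n := by have := I.connected.nonempty.some.2; omega
  have hk := I.k_pos
  suffices h : ∃ β D₀, D₀ ≤ I.aG + I.k ∧ β + 1 ≤ 21 * (I.aG + I.k) ^ 3 ∧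
      DecidesWithin program I.encode I.IsYes (programTime I.n I.k β D₀) by
    obtain ⟨β, D₀, h1, h2, h3⟩ := h
    exact DecidesWithin.mono h3 ((programTime_le hn hk (by omega) h1 h2).trans (pow_le_timeConst hk))
  set a := I.aG with ha
  have hm : a + I.k ≤ (a + I.k) ^ 3 := Nat.le_self_pow (by omega) _
  by_cases hyes : I.IsYes
  · obtain ⟨f, hf, hfa⟩ : ∃ f, IsGridEmbedding I.graph I.k I.r f ∧ distApprox I.graph f = a := by
      have : a = sInf {a | ∃ f, IsGridEmbedding I.graph I.k I.r f ∧ distApprox I.graph f = a} := by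
        rw [ha, GridInstance.aG, distApproxParam,
          if_pos (c := IsGridGraph I.graph I.k I.r) hyes]
      rw [this]
      obtain ⟨f, hf⟩ := hyes
      exact Nat.sInf_mem (s := {a | ∃ f, IsGridEmbedding I.graph I.k I.r f ∧
        distApprox I.graph f = a}) ⟨_, f, hf, rfl⟩
    -- The loop over `D` stops at `n`. The cap does no harm, since a shortest path has at most `n`
    -- vertices and levels are thus at most `n`.
    set D₀ := min I.n (a + I.k)
    have hDm : D₀ ≤ a + I.k := min_le_right _ _
    refine ⟨I.k * (2 * (2 * ((2 * I.k + 2) * D₀) + a + I.k + 1)), D₀, hDm, ?_,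
      program_decides I (by omega) (min_le_left _ _) ⟨0, hn⟩ rfl ?_ ?_ fun h => absurd hyes h⟩
    · set m := a + I.k
      have hkm : I.k ≤ m := by omega
      have h1 : (2 * I.k + 2) * D₀ ≤ 4 * (m * m) := by
        calc (2 * I.k + 2) * D₀ ≤ (4 * m) * m := Nat.mul_le_mul (by omega) hDm
          _ = _ := by ring
      have h2 : m ≤ m * m := Nat.le_mul_self m
      calc I.k * (2 * (2 * ((2 * I.k + 2) * D₀) + a + I.k + 1)) + 1 ≤ m * (20 * (m * m)) + 1 :=
            Nat.add_le_add_right (Nat.mul_le_mul hkm (by omega)) 1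
        _ = 20 * m ^ 3 + 1 := by ring
        _ ≤ 21 * m ^ 3 := by omega
    · intro lev hlev x hx
      have := card_near_le_of_embedding I.connected hf hlev ((2 * I.k + 2) * D₀) x hx
      rwa [hfa] at this
    · intro _ lev hlev
      have hclose : ∀ u v, (f u).2 ≤ (f v).2 + 1 → (f v).2 ≤ (f u).2 + 1 →
          lev (u.val + 1) ≤ lev (v.val + 1) + D₀ := by
        intro u v h1 h2
        have h3 := lev_le_of_column I.connected hf hlev h1 h2
        rw [hfa] at h3
        have h4 : lev (u.val + 1) ≤ I.n := by
          rw [hlev]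
          obtain ⟨p, hp, hpl⟩ := I.connected.exists_path_of_dist ⟨0, hn⟩ u
          have := hp.length_lt
          rw [Fintype.card_fin] at this
          omega
        omega
      refine ⟨_, valid_ofEmbedding hf I.connected hclose ((I.r + 1) * (I.k + 1) - 1),
        complete_ofEmbedding hf I.connected hclose, ?_⟩
      rw [length_ofEmbedding]
      have : 0 < (I.r + 1) * (I.k + 1) := by positivity
      omega
  -- Without an embedding `a_G = n` by definition, so the trivial choices `β = D₀ = n` are within
  -- the bounds.
  · have hna : a = I.n := by
      rw [ha, GridInstance.aG, distApproxParam, if_neg (c := IsGridGraph I.graph I.k I.r) hyes,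
        Fintype.card_fin]
    exact ⟨I.n, I.n, by omega, by omega, program_decides I hn le_rfl ⟨0, hn⟩ rfl
      (fun lev _ x _ => card_near_le _ _) (fun h => absurd h hyes) fun _ => rfl⟩

theorem primrec_pow : Primrec₂ ((· ^ ·) : ℕ → ℕ → ℕ) :=
  Primrec₂.unpaired'.1 Nat.Primrec.pow

end GridSearch

theorem theorem1p5 :
    RAM.IsFPT GridInstance.encode GridInstance.size GridInstance.IsYes
        (fun I => I.aG + I.k) ∧
      ∃ (p : RAM.Prog) (c : ℕ), ∀ I : GridInstance,
        RAM.DecidesWithin p I.encode I.IsYes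
          (c * (I.n ^ 2 * (I.k * max 1 I.aG) ^ (c * (I.k * I.aG + I.k ^ 2)))) := by
  -- Both `k * max 1 a_G` and `k * a_G + k ^ 2` are at most `(a_G + k) ^ 2`, which gives the
  -- computable function. As `n ^ 2` is at most the input size, the exponent `1` suffices.
  refine ⟨⟨GridSearch.program, fun m => GridSearch.timeConst *
    (m * m) ^ (GridSearch.timeConst * (m * m)), 1, ?_, fun I => ?_⟩,
    GridSearch.program, GridSearch.timeConst, GridSearch.program_decidesWithin⟩
  · have hsq : Primrec fun m : ℕ => m * m := Primrec.nat_mul.comp .id .id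
    exact (Primrec.nat_mul.comp (.const _)
      (GridSearch.primrec_pow.comp hsq (Primrec.nat_mul.comp (.const _) hsq))).to_comp
  · refine GridSearch.DecidesWithin.mono (GridSearch.program_decidesWithin I) ?_
    have hk := I.k_pos
    have h1 : I.n ^ 2 ≤ I.size := by
      rw [GridInstance.size]; omega
    have h2 : I.k * max 1 I.aG ≤ (I.aG + I.k) * (I.aG + I.k) :=
      Nat.mul_le_mul (by omega) (by omega)
    have h3 : I.k * I.aG + I.k ^ 2 ≤ (I.aG + I.k) * (I.aG + I.k) := by nlinarith
    have h4 : 0 < (I.aG + I.k) * (I.aG + I.k) := by positivity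
    rw [pow_one, mul_comm (I.n ^ 2), ← mul_assoc]
    refine Nat.mul_le_mul (Nat.mul_le_mul_left _ ?_) h1
    exact (Nat.pow_le_pow_left h2 _).trans (Nat.pow_le_pow_right h4 (Nat.mul_le_mul_left _ h3))
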